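/- Let $n,m\ge 1$ and let $\Gamma$ and $\Lambda$ be discrete groups. Assume that $\Gamma$ has the finiteness property $FP_\infty(\mathbb{Q})$, i.e. for every $N\ge 0$ the trivial $\mathbb{Q}\Gamma$-module $\mathbb{Q}$ admits a resolution by projective $\mathbb{Q}\Gamma$-modules that are finitely generated in degrees up to $N$. A discrete group $G$ is said to have property $(T_n)$ if $H^j(G,V)=0$ for every $1\le j\le n$ and every unitary representation of $G$ on a complex Hilbert space $V$ without nonzero $G$-invariant vectors. Suppose that $\Gamma$ has property $(T_n)$ and $\Lambda$ has property $(T_m)$. Then $$H^k(\Gamma\times\Lambda,V)=0\qquad\text{for } 0\le k\le n+m+1$$ and every unitary representation of $\Gamma\times\Lambda$ on a complex Hilbert space $V$ with $V^\Gamma=0$ and $V^\Lambda=0$. -/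

import Mathlib

open CategoryTheory

noncomputable section

namespace HigherPropertyT

/-- The linear representation underlying a unitary representation `π` of a (discrete) group `G` on
a complex Hilbert space `V`. -/
def toRep {G : Type} [Group G] {V : Type} [NormedAddCommGroup V] [InnerProductSpace ℂ V]
    [CompleteSpace V] (π : G →* unitary (V →L[ℂ] V)) : Representation ℂ G V :=
  (ContinuousLinearMap.toLinearMapRingHom (R₁ := ℂ) (M₁ := V)).toMonoidHom.comp
    ((unitary (V →L[ℂ] V)).subtype.comp π)

/-- The group cohomology `H^k(G, V)` of the discrete group `G` with coefficients in the unitary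
representation `π` of `G` on `V`. -/
abbrev cohomology {G : Type} [Group G] {V : Type} [NormedAddCommGroup V] [InnerProductSpace ℂ V]
    [CompleteSpace V] (π : G →* unitary (V →L[ℂ] V)) (k : ℕ) : ModuleCat ℂ :=
  groupCohomology (Rep.of (toRep π)) k

/-- The unitary representation `π` of `G` on `V` has no nonzero invariant vector: `V^G = 0`. -/
def NoInvariants {G : Type} [Group G] {V : Type} [NormedAddCommGroup V] [InnerProductSpace ℂ V]
    [CompleteSpace V] (π : G →* unitary (V →L[ℂ] V)) : Prop :=
  ∀ v : V, (∀ g : G, (π g : V →L[ℂ] V) v = v) → v = 0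

/-- Property `(T_n)` of a discrete group `G`: `H^j(G, V) = 0` for all `1 ≤ j ≤ n` and every unitary
representation of `G` on a complex Hilbert space `V` without nonzero invariant vectors. -/
def PropertyT (n : ℕ) (G : Type) [Group G] : Prop :=
  ∀ (V : Type) [NormedAddCommGroup V] [InnerProductSpace ℂ V] [CompleteSpace V]
    (π : G →* unitary (V →L[ℂ] V)), NoInvariants π →
      ∀ j : ℕ, 1 ≤ j → j ≤ n → Subsingleton (cohomology π j)

/-- The finiteness property `FP_n(ℚ)`: the trivial `ℚ[G]`-module `ℚ` has a resolution by projective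
`ℚ[G]`-modules that are finitely generated in degrees up to `n`. -/
def FP (n : ℕ) (G : Type) [Group G] : Prop :=
  ∃ P : ProjectiveResolution
      (ModuleCat.of (MonoidAlgebra ℚ G) (Representation.trivial ℚ G ℚ).asModule),
    ∀ i ≤ n, Module.Finite (MonoidAlgebra ℚ G) (P.complex.X i)

/-- The finiteness property `FP_∞(ℚ)`: `FP_n(ℚ)` for all `n`. -/
def FPInfty (G : Type) [Group G] : Prop :=
  ∀ n : ℕ, FP n G

end HigherPropertyT

end

/-! Choose a resolution of ℚ by free ℚ[Γ]-modules ℚ[Γ]^(r q), finitely generated in a long enough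
range. With Λ acting trivially it is a resolution over G = Γ × Λ, and Ext_G(ℚ[Γ]^r, V) = Ext_Λ(ℚ,
V^r). Hence there is a spectral sequence with E₁^{q,j} = Ext_Λ^j(ℚ, V^(r q)) converging to
H^(q+j)(G, V). Since V^r is again unitary without Λ-invariants, property (T_m) of Λ kills E₁ for j ≤
m. If E₂ vanishes for q ≤ n, nothing survives in total degree ≤ n + m + 1; `ext_eq_zero_of_exact`
proves this by dimension shifting.

For E₂, property (T_n) of Γ says that V^(r 0) → V^(r 1) → ⋯ is exact in degrees ≤ n
(`PropertyT.unitaryExact`). To keep exactness after applying Ext_Λ^j, one needs a contraction by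
Λ-maps (`ext_outer_exact`). The differentials are bounded operators commuting with the unitary
action of Λ. If their ranges are closed, their Moore–Penrose pseudoinverses are Λ-equivariant
(`IsPseudoinverse.comm`) and form a contraction in degrees ≤ n (`IsPseudoinverse.add_eq`).

Closed range is the analytic core (`UnitaryExact.isClosed_range`). Below degree n the range is the
kernel of the next differential. In degree n, a failure yields unit vectors orthogonal to the kernel
whose images tend to 0; in an ultrapower of V they become a unit cocycle orthogonal to all
coboundaries, contradicting (T_n) there. The ultrapower has no invariant vectors because the first
differential is bounded below, and this uses n ≥ 1.

Homological algebra is done over ℚ, where the finiteness hypothesis lives; vanishing over ℂ and over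
ℚ agree by `inhomogeneousCochains_d_ratRep`. -/

namespace HigherPropertyT

/-! ### Partial resolutions by finitely generated free modules -/

section FiniteFree

variable (R : Type) [Ring R]

/-- `M` admits a partial resolution by finitely generated free modules up to degree `n`. -/
def FiniteFreeUpTo : ℕ → ∀ (M : Type) [AddCommGroup M] [Module R M], Prop
  | 0, M, _, _ => Module.Finite R M
  | n + 1, M, _, _ => ∃ (r : ℕ) (f : (Fin r → R) →ₗ[R] M),
      Function.Surjective f ∧ FiniteFreeUpTo n (LinearMap.ker f)

variable {R}
variable {M M' K : Type} [AddCommGroup M] [Module R M] [AddCommGroup M'] [Module R M']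
  [AddCommGroup K] [Module R K]

lemma FiniteFreeUpTo.of_equiv {n : ℕ} (h : FiniteFreeUpTo R n M) (e : M ≃ₗ[R] M') :
    FiniteFreeUpTo R n M' := by
  induction n generalizing M M' with
  | zero =>
    have : Module.Finite R M := h
    exact Module.Finite.equiv e
  | succ n ih =>
    obtain ⟨r, f, hf, hk⟩ := h
    refine ⟨r, e.toLinearMap.comp f, e.surjective.comp hf, ih hk (LinearEquiv.ofEq _ _ ?_)⟩
    ext x
    simp

/-- Frees the recursive definition from the literal kernel inside `Fin r → R`: any short exact
sequence with a free middle term will do. -/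
lemma FiniteFreeUpTo.of_exact {n r : ℕ} {F : Type} [AddCommGroup F] [Module R F]
    (e : (Fin r → R) ≃ₗ[R] F) (g : K →ₗ[R] F) (f : F →ₗ[R] M) (hg : Function.Injective g)
    (hf : Function.Surjective f) (hgf : Function.Exact g f) (h : FiniteFreeUpTo R n K) :
    FiniteFreeUpTo R (n + 1) M := by
  refine ⟨r, f.comp e.toLinearMap, hf.comp e.surjective, h.of_equiv ?_⟩
  refine LinearEquiv.ofBijective
    ((e.symm.toLinearMap.comp g).codRestrict _ fun x => ?_) ⟨?_, ?_⟩
  · simp [hgf.apply_apply_eq_zero]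
  · intro x y hxy
    apply hg
    apply e.symm.injective
    simpa using congrArg Subtype.val hxy
  · rintro ⟨x, hx⟩
    obtain ⟨y, hy⟩ := (hgf _).1 (show f (e x) = 0 from hx)
    exact ⟨y, Subtype.ext (by simp [hy])⟩

lemma FiniteFreeUpTo.prod {n : ℕ} (h : FiniteFreeUpTo R n M) (h' : FiniteFreeUpTo R n M') :
    FiniteFreeUpTo R n (M × M') := by
  induction n generalizing M M' with
  | zero =>
    have : Module.Finite R M := h
    have : Module.Finite R M' := h'
    exact (inferInstance : Module.Finite R (M × M'))
  | succ n ih =>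
    obtain ⟨r, f, hf, hk⟩ := h
    obtain ⟨r', f', hf', hk'⟩ := h'
    refine FiniteFreeUpTo.of_exact (r := r + r')
      ((LinearEquiv.funCongrLeft R R finSumFinEquiv).trans
        (LinearEquiv.sumArrowLequivProdArrow (Fin r) (Fin r') R R))
      ((LinearMap.ker f).subtype.prodMap (LinearMap.ker f').subtype) (f.prodMap f')
      ?_ (hf.prodMap hf') ?_ (ih hk hk')
    · exact (Submodule.subtype_injective _).prodMap (Submodule.subtype_injective _)
    · rintro ⟨x, y⟩
      constructor
      · intro hxy
        simp only [LinearMap.prodMap_apply, Prod.mk_eq_zero] at hxy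
        exact ⟨(⟨x, hxy.1⟩, ⟨y, hxy.2⟩), rfl⟩
      · rintro ⟨⟨⟨x, hx⟩, ⟨y, hy⟩⟩, h⟩
        rw [← h]
        exact Prod.ext hx hy

/-- A free cover of a projective module splits, so its kernel is again finitely generated projective
and the induction continues. -/
lemma FiniteFreeUpTo.of_projective (n : ℕ) [Module.Finite R M] [Module.Projective R M] :
    FiniteFreeUpTo R n M := by
  induction n generalizing M with
  | zero => exact (inferInstance : Module.Finite R M)
  | succ n ih =>
    obtain ⟨r, f, hf⟩ := Module.Finite.exists_fin' R M
    obtain ⟨s, hs⟩ := Module.projective_lifting_property f LinearMap.id hf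
    have hs' : ∀ x, f (s x) = x := fun x => LinearMap.congr_fun hs x
    let t : (Fin r → R) →ₗ[R] LinearMap.ker f :=
      (LinearMap.id - s.comp f).codRestrict _ fun x => by simp [hs']
    have ht : t.comp (LinearMap.ker f).subtype = LinearMap.id := by
      ext ⟨x, hx⟩ : 2
      have : f x = 0 := hx
      simp [t, this]
    have : Module.Projective R (LinearMap.ker f) := Module.Projective.of_split _ _ ht
    have : Module.Finite R (LinearMap.ker f) :=
      Module.Finite.of_surjective t fun x => ⟨x, LinearMap.congr_fun ht x⟩
    exact ⟨r, f, hf, ih⟩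

/-- With a split free cover `p` of `P`, the kernel of `f ∘ p` is `K ⊕ ker p`, and `ker p` is
finitely generated projective. -/
lemma FiniteFreeUpTo.of_projective_cover {n : ℕ} {P : Type} [AddCommGroup P] [Module R P]
    [Module.Finite R P] [Module.Projective R P] (g : K →ₗ[R] P) (f : P →ₗ[R] M)
    (hg : Function.Injective g) (hf : Function.Surjective f) (hgf : Function.Exact g f)
    (h : FiniteFreeUpTo R n K) : FiniteFreeUpTo R (n + 1) M := by
  obtain ⟨r, p, hp⟩ := Module.Finite.exists_fin' R P
  obtain ⟨s, hs⟩ := Module.projective_lifting_property p LinearMap.id hp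
  have hs' : ∀ x, p (s x) = x := fun x => LinearMap.congr_fun hs x
  let t : (Fin r → R) →ₗ[R] LinearMap.ker p :=
    (LinearMap.id - s.comp p).codRestrict _ fun x => by simp [hs']
  have ht : t.comp (LinearMap.ker p).subtype = LinearMap.id := by
    ext ⟨x, hx⟩ : 2
    have : p x = 0 := hx
    simp [t, this]
  have : Module.Projective R (LinearMap.ker p) := Module.Projective.of_split _ _ ht
  have : Module.Finite R (LinearMap.ker p) :=
    Module.Finite.of_surjective t fun x => ⟨x, LinearMap.congr_fun ht x⟩
  refine FiniteFreeUpTo.of_exact (LinearEquiv.refl R (Fin r → R))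
    ((s.comp g).coprod (LinearMap.ker p).subtype) (f.comp p) ?_ (hf.comp hp) ?_
    (h.prod (FiniteFreeUpTo.of_projective n (M := LinearMap.ker p)))
  · rw [← LinearMap.ker_eq_bot, LinearMap.ker_eq_bot']
    rintro ⟨k, ⟨q, hq⟩⟩ h0
    have hq' : p q = 0 := hq
    simp only [LinearMap.coprod_apply, LinearMap.comp_apply, Submodule.subtype_apply] at h0
    have h1 := congrArg p h0
    simp only [map_add, hs', hq', add_zero, map_zero] at h1
    have hk : k = 0 := hg (by simpa using h1)
    subst hk
    simpa using h0
  · intro x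
    constructor
    · intro hx
      obtain ⟨k, hk⟩ := (hgf _).1 hx
      refine ⟨(k, t x), ?_⟩
      simp [hk, t]
    · rintro ⟨⟨k, ⟨q, hq⟩⟩, rfl⟩
      have hq' : p q = 0 := hq
      simp [hs', hq', hgf.apply_apply_eq_zero]

/-- The free modules and differentials extracted from `FiniteFreeUpTo`. -/
lemma FiniteFreeUpTo.exists_complex {n : ℕ} (h : FiniteFreeUpTo R n M) :
    ∃ (r : ℕ → ℕ) (D : ∀ q, (Fin (r (q + 1)) → R) →ₗ[R] (Fin (r q) → R))
      (ε : (Fin (r 0) → R) →ₗ[R] M), Function.Surjective ε ∧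
      (0 < n → Function.Exact (D 0) ε) ∧ ∀ q, q + 1 < n → Function.Exact (D (q + 1)) (D q) := by
  induction n generalizing M with
  | zero =>
    have : Module.Finite R M := h
    obtain ⟨r, f, hf⟩ := Module.Finite.exists_fin' R M
    -- Nothing is claimed about the differentials here, so zero maps serve as padding.
    exact ⟨fun _ => r, fun _ => 0, f, hf, by simp, by simp⟩
  | succ n ih =>
    obtain ⟨r₀, f, hf, hk⟩ := h
    obtain ⟨r, D, ε, hε, h0, hD⟩ := ih hk
    let r' : ℕ → ℕ := fun q => Nat.casesOn q r₀ r
    let D' : ∀ q, (Fin (r' (q + 1)) → R) →ₗ[R] (Fin (r' q) → R)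
      | 0 => (LinearMap.ker f).subtype.comp ε
      | q + 1 => D q
    refine ⟨r', D', f, hf, fun _ x => ?_, fun q hq => ?_⟩
    · constructor
      · intro hx
        obtain ⟨y, hy⟩ := hε ⟨x, hx⟩
        exact ⟨y, congrArg Subtype.val hy⟩
      · rintro ⟨y, rfl⟩
        exact (ε y).2
    · cases q with
      | zero =>
        intro x
        rw [← h0 (by omega) x]
        exact (LinearMap.ker f).subtype_injective.eq_iff' rfl
      | succ q => exact hD q (by omega)

/-- A projective resolution which is finitely generated up to degree `n` can be replaced by a
finitely generated free one up to degree `n`. -/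
lemma finiteFreeUpTo_of_projectiveResolution {M : ModuleCat.{0} R} (P : ProjectiveResolution M)
    {n : ℕ} (hP : ∀ i ≤ n, Module.Finite R (P.complex.X i)) : FiniteFreeUpTo R n M := by
  have hproj : ∀ i, Module.Projective R (P.complex.X i) := fun i =>
    (IsProjective.iff_projective _).2 (P.projective i)
  have hex : ∀ i, Function.Exact (P.complex.d (i + 2) (i + 1)).hom (P.complex.d (i + 1) i).hom :=
    fun i => (ShortComplex.ShortExact.moduleCat_exact_iff_function_exact _).1 (P.exact_succ i)
  -- By exactness, each image of a differential is covered by the next projective with kernel the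
  -- next image; `k` counts the finitely generated terms still available.
  have key : ∀ (k i : ℕ), i + 1 + k ≤ n →
      FiniteFreeUpTo R k (LinearMap.range (P.complex.d (i + 1) i).hom) := by
    intro k
    induction k with
    | zero =>
      intro i hi
      have := hP (i + 1) (by omega)
      exact (inferInstance : Module.Finite R (LinearMap.range (P.complex.d (i + 1) i).hom))
    | succ k ih =>
      intro i hi
      have := hP (i + 1) (by omega)
      refine FiniteFreeUpTo.of_projective_cover
        (LinearMap.range (P.complex.d (i + 2) (i + 1)).hom).subtype
        (P.complex.d (i + 1) i).hom.rangeRestrict (Submodule.subtype_injective _)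
        (LinearMap.surjective_rangeRestrict _) ?_ (ih (i + 1) (by omega))
      intro x
      rw [← Subtype.coe_inj]
      simpa using hex i x
  cases n with
  | zero =>
    have := hP 0 le_rfl
    exact Module.Finite.of_surjective (P.π.f 0).hom
      ((ModuleCat.epi_iff_surjective _).1 inferInstance)
  | succ n =>
    have := hP 0 (by omega)
    refine FiniteFreeUpTo.of_projective_cover
        (LinearMap.range (P.complex.d 1 0).hom).subtype
        (P.π.f 0).hom (Submodule.subtype_injective _)
        ((ModuleCat.epi_iff_surjective _).1 inferInstance) ?_ (key n 0 (by omega))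
    have h0 : Function.Exact (P.complex.d 1 0).hom (P.π.f 0).hom :=
      (ShortComplex.ShortExact.moduleCat_exact_iff_function_exact _).1 P.exact₀
    intro x
    refine (h0 x).trans ?_
    rw [Submodule.coe_subtype, Subtype.range_coe]
    rfl

end FiniteFree

end HigherPropertyT

/-! ### Dimension shifting along a resolution in place of a spectral sequence -/

namespace HigherPropertyT

open Limits

section ExtComplex

universe w v u

variable {C : Type u} [Category.{v} C] [Abelian C]

variable (X : ℕ → C) (g : ∀ q, X (q + 1) ⟶ X q)

/-- The short complex `im (g (q+1)) ⟶ X (q+1) ⟶ im (g q)`. -/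
noncomputable abbrev imageShortComplex (q : ℕ) (h : g (q + 1) ≫ g q = 0) : ShortComplex C :=
  ShortComplex.mk (image.ι (g (q + 1))) (factorThruImage (g q)) (by
    rw [← cancel_epi (factorThruImage (g (q + 1))), ← cancel_mono (image.ι (g q))]
    simp [h])

variable {X g}

/-- Exactness in the middle is unaffected by shrinking the last object to the image (a mono) or the
first one to its image (an epi). -/
lemma imageShortComplex_shortExact {q : ℕ} {h : g (q + 1) ≫ g q = 0}
    (hex : (ShortComplex.mk _ _ h).Exact) : (imageShortComplex X g q h).ShortExact where
  mono_f := by dsimp; infer_instance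
  epi_g := by dsimp; infer_instance
  exact := by
    let S' : ShortComplex C := ShortComplex.mk (g (q + 1)) (factorThruImage (g q)) (by
      rw [← cancel_mono (image.ι (g q))]; simp [h])
    let φ : S' ⟶ ShortComplex.mk _ _ h :=
      { τ₁ := 𝟙 _, τ₂ := 𝟙 _, τ₃ := image.ι (g q) }
    let ψ : S' ⟶ imageShortComplex X g q h :=
      { τ₁ := factorThruImage (g (q + 1)), τ₂ := 𝟙 _, τ₃ := 𝟙 _
        comm₁₂ := by simp [S']
        comm₂₃ := by simp [S'] }
    have : Epi φ.τ₁ := by dsimp [φ, S']; infer_instance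
    have : IsIso φ.τ₂ := by dsimp [φ, S']; infer_instance
    have : Mono φ.τ₃ := by dsimp [φ, S']; infer_instance
    have : Epi ψ.τ₁ := by dsimp [ψ, S']; infer_instance
    have : IsIso ψ.τ₂ := by dsimp [ψ, S']; infer_instance
    have : Mono ψ.τ₃ := by dsimp [ψ, S']; infer_instance
    rw [← ShortComplex.exact_iff_of_epi_of_isIso_of_mono ψ,
      ShortComplex.exact_iff_of_epi_of_isIso_of_mono φ]
    exact hex

variable [HasExt.{w} C]

/-- Pullback of `Ext`-classes along a morphism in the first variable. -/
noncomputable def extPullback {X X' : C} (f : X' ⟶ X) {Y : C} {n : ℕ} (x : Abelian.Ext X Y n) :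
    Abelian.Ext X' Y n :=
  (Abelian.Ext.mk₀ f).comp x (zero_add n)

section
variable {X X' X'' Y : C} {n : ℕ}

@[simp] lemma extPullback_zero (f : X' ⟶ X) : extPullback f (0 : Abelian.Ext X Y n) = 0 :=
  Abelian.Ext.comp_zero _ _ _ _ _

@[simp] lemma extPullback_zero_left (x : Abelian.Ext X Y n) :
    extPullback (0 : X' ⟶ X) x = 0 := by
  simp [extPullback]

lemma extPullback_sub (f : X' ⟶ X) (x y : Abelian.Ext X Y n) :
    extPullback f (x - y) = extPullback f x - extPullback f y := by
  simp [extPullback, sub_eq_add_neg, Abelian.Ext.comp_add, Abelian.Ext.comp_neg]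

lemma extPullback_comp (f : X' ⟶ X) (g : X'' ⟶ X') (x : Abelian.Ext X Y n) :
    extPullback (g ≫ f) x = extPullback g (extPullback f x) := by
  simp [extPullback]

end

variable {N : ℕ} (hz : ∀ q < N, g (q + 1) ≫ g q = 0)
  (hex : ∀ q (hq : q < N), (ShortComplex.mk _ _ (hz q hq)).Exact) {Y : C}

include hex

/-- If `Ext^j(X (q+1), Y)` vanishes for `j ≤ m`, then the images of the differentials
have the same property. -/
lemma ext_image_eq_zero {m : ℕ}
    (h1 : ∀ q j, j ≤ m → j + q < N + 1 → ∀ x : Abelian.Ext (X (q + 1)) Y j, x = 0) :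
    ∀ j q, j ≤ m → j + q < N + 1 → ∀ x : Abelian.Ext (image (g q)) Y j, x = 0 := by
  intro j
  induction j with
  | zero =>
    intro q _ hq x
    apply Abelian.Ext.precomp_mk₀_injective_of_epi Y (factorThruImage (g q))
    exact (h1 q 0 (by omega) hq _).trans (h1 q 0 (by omega) hq _).symm
  | succ j ih =>
    intro q hj hq x
    have hS := imageShortComplex_shortExact (hex q (by omega))
    -- A class dying on `X (q + 1)` is a connecting image from the next syzygy, one degree lower;
    -- the sum of degree and position is constant.
    obtain ⟨y, rfl⟩ := Abelian.Ext.contravariant_sequence_exact₃ hS Y x (h1 q _ hj hq _)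
      (n₀ := j) (by omega)
    rw [ih (q + 1) (by omega) (by omega) y]
    exact Abelian.Ext.comp_zero _ _ _ _ _

/-- A vanishing result for the hypercohomology spectral sequence
`Ext^j(X (q+1), Y) ⇒ Ext^(q+j)(X 0, Y)` of a resolution `X (• + 1) → X 0`: the first page vanishes
in degrees `j ≤ m` and the second page in degrees `q ≤ n`. -/
lemma ext_eq_zero_of_exact [Epi (g 0)] {n m : ℕ} (hN : n + m + 1 ≤ N)
    (h1 : ∀ q j, j ≤ m → j + q < N + 1 → ∀ x : Abelian.Ext (X (q + 1)) Y j, x = 0)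
    (h2 : ∀ q j, q + 1 ≤ n → ∀ x : Abelian.Ext (X (q + 2)) Y j, extPullback (g (q + 2)) x = 0 →
      ∃ y : Abelian.Ext (X (q + 1)) Y j, extPullback (g (q + 1)) y = x)
    (h3 : ∀ j, ∀ x : Abelian.Ext (X 1) Y j, extPullback (g 1) x = 0 → x = 0)
    (k : ℕ) (hk : k ≤ n + m + 1) (x : Abelian.Ext (X 0) Y k) : x = 0 := by
  have hv := ext_image_eq_zero hz hex h1
  -- Pullback from the syzygy `image (g q)` to `X (q + 1)` is injective in total degree ≤ `n + m +
  -- 1`. The induction descends in `q` from `n + 1`, where `j ≤ m` and everything vanishes.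
  have key : ∀ i q j, q + i = n + 1 → j + q ≤ n + m + 1 → ∀ x : Abelian.Ext (image (g q)) Y j,
      extPullback (factorThruImage (g q)) x = 0 → x = 0 := by
    intro i
    induction i with
    | zero =>
      intro q j hq hj x _
      exact hv j q (by omega) (by omega) x
    | succ i ih =>
      intro q j hq hj x hx
      rcases j with _ | j
      · exact hv 0 q (by omega) (by omega) x
      have hS := imageShortComplex_shortExact (hex q (by omega))
      obtain ⟨(y : Abelian.Ext (image (g (q + 1))) Y j), rfl⟩ :=
        Abelian.Ext.contravariant_sequence_exact₃ hS Y x hx (n₀ := j) (by omega)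
      -- The connecting map kills restrictions of classes on `X (q + 1)`, so it is enough to extend
      -- `y` there.
      suffices ∃ z : Abelian.Ext (X (q + 1)) Y j, extPullback (image.ι (g (q + 1))) z = y by
        obtain ⟨z, rfl⟩ := this
        exact hS.extClass_comp_assoc _
      by_cases hqn : q + 1 ≤ n
      · obtain ⟨z, hz'⟩ := h2 q j hqn (extPullback (factorThruImage (g (q + 1))) y) (by
          rw [← extPullback_comp]
          have : g (q + 2) ≫ factorThruImage (g (q + 1)) = 0 := by
            rw [← cancel_mono (image.ι (g (q + 1)))]
            simp [hz (q + 1) (by omega)]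
          rw [this, extPullback_zero_left])
        -- `z` and `y` agree after pullback to `X (q + 2)`; the induction hypothesis makes that
        -- pullback injective.
        refine ⟨z, sub_eq_zero.1 (ih (q + 1) j (by omega) (by omega) _ ?_)⟩
        rw [extPullback_sub, ← hz', ← extPullback_comp, image.fac, sub_self]
      -- Here `q = n`, so `j ≤ m` and `y` itself vanishes.
      · refine ⟨0, ?_⟩
        rw [extPullback_zero, hv j (q + 1) (by omega) (by omega) y]
  have hiso : IsIso (image.ι (g 0)) := by
    have : Epi (image.ι (g 0)) := epi_of_epi_fac (image.fac (g 0))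
    exact isIso_of_mono_of_epi _
  have h0 : extPullback (image.ι (g 0)) x = 0 := by
    refine key (n + 1) 0 k (by omega) (by omega) _ (h3 _ _ ?_)
    rw [← extPullback_comp, ← extPullback_comp, Category.assoc, image.fac, hz 0 (by omega),
      extPullback_zero_left]
  have h4 : extPullback (inv (image.ι (g 0))) (extPullback (image.ι (g 0)) x) = x := by
    rw [← extPullback_comp]
    simp [extPullback]
  rw [← h4, h0, extPullback_zero]

/-- If `X (• + 1) → X 0` is a projective resolution and `Ext^j(X 0, Y) = 0` for `j ≤ n`, then the
complex `Hom(X (• + 1), Y)` is exact in degrees `≤ n`. -/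
lemma hom_exact_of_ext_eq_zero [Epi (g 0)] [∀ q, Projective (X (q + 1))] {n : ℕ} (hN : n + 1 ≤ N)
    (h0 : ∀ j ≤ n, ∀ x : Abelian.Ext (X 0) Y j, x = 0) :
    (∀ f : X 1 ⟶ Y, g 1 ≫ f = 0 → f = 0) ∧
    ∀ q, q + 1 ≤ n → ∀ f : X (q + 2) ⟶ Y, g (q + 2) ≫ f = 0 →
      ∃ f' : X (q + 1) ⟶ Y, g (q + 1) ≫ f' = f := by
  have hiso : IsIso (image.ι (g 0)) := by
    have : Epi (image.ι (g 0)) := epi_of_epi_fac (image.fac (g 0))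
    exact isIso_of_mono_of_epi _
  have hI : ∀ j ≤ n, ∀ x : Abelian.Ext (image (g 0)) Y j, x = 0 := by
    intro j hj x
    have h4 : extPullback (image.ι (g 0)) (extPullback (inv (image.ι (g 0))) x) = x := by
      rw [← extPullback_comp]
      simp [extPullback]
    rw [← h4, h0 j hj (extPullback (inv (image.ι (g 0))) x), extPullback_zero]
  -- Projectivity of `X (q + 1)` embeds `Ext` of a syzygy into `Ext` of the preceding one, one
  -- degree higher.
  have hq : ∀ q j, j + 1 + q ≤ n → ∀ x : Abelian.Ext (image (g q)) Y (j + 1), x = 0 := by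
    intro q
    induction q with
    | zero => exact fun j hj x => hI _ (by omega) x
    | succ q ih =>
      intro j hj x
      have hS := imageShortComplex_shortExact (hex q (by omega))
      obtain ⟨y, rfl⟩ := Abelian.Ext.contravariant_sequence_exact₁ hS Y x (n₁ := j + 2) (by omega)
        (ih (j + 1) (by omega) _)
      have hy : y = 0 := Abelian.Ext.eq_zero_of_projective (P := X (q + 1)) y
      rw [hy]
      exact Abelian.Ext.comp_zero _ _ _ _ _
  have hfac : ∀ q < N, ∀ f : X (q + 1) ⟶ Y, g (q + 1) ≫ f = 0 →
      ∃ u : image (g q) ⟶ Y, factorThruImage (g q) ≫ u = f := by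
    intro q hq f hf
    have hS := imageShortComplex_shortExact (hex q hq)
    have := hS.epi_g
    refine ⟨hS.exact.desc f ?_, hS.exact.g_desc _ _⟩
    rw [← cancel_epi (factorThruImage (g (q + 1)))]
    simpa using hf
  refine ⟨fun f hf => ?_, fun q hqn f hf => ?_⟩
  · obtain ⟨u, rfl⟩ := hfac 0 (by omega) f hf
    have : u = 0 := (Abelian.Ext.mk₀_eq_zero_iff u).1 (hI 0 (by omega) _)
    simp [this]
  · obtain ⟨u, rfl⟩ := hfac (q + 1) (by omega) f hf
    have hS := imageShortComplex_shortExact (hex q (by omega))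
    -- The obstruction to extending `u` from the image to `X (q + 1)` lies in an `Ext¹` that has
    -- just been shown to vanish.
    obtain ⟨y, hy⟩ := Abelian.Ext.contravariant_sequence_exact₁ hS Y (Abelian.Ext.mk₀ u)
        (n₁ := 1) (by omega)
      (hq q 0 (by omega) _)
    obtain ⟨f', rfl⟩ := Abelian.Ext.addEquiv₀.symm.surjective y
    refine ⟨f', ?_⟩
    have h5 : image.ι (g (q + 1)) ≫ f' = u := by
      apply Abelian.Ext.addEquiv₀.symm.injective
      simpa using hy
    rw [← h5, image.fac_assoc]

end ExtComplex

end HigherPropertyT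

/-! ### External tensor products of representations -/

namespace HigherPropertyT

open TensorProduct

instance hasExt_rep (k G : Type) [CommRing k] [Group G] : HasExt.{0} (Rep.{0} k G) :=
  hasExt_of_enoughProjectives _

lemma rep_exact_iff {k G : Type} [CommRing k] [Group G] (S : ShortComplex (Rep.{0} k G)) :
    S.Exact ↔ Function.Exact S.f.hom S.g.hom := by
  rw [← ShortComplex.exact_map_iff_of_faithful S (forget₂ (Rep.{0} k G) (ModuleCat.{0} k)),
    ShortComplex.ShortExact.moduleCat_exact_iff_function_exact]
  rfl

section Twist

variable {Γ : Type} [Group Γ]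

/-- The representation of `Γ` on a `ℚ[Γ]`-module. -/
noncomputable def moduleRep (K : Type) [AddCommGroup K] [Module ℚ K] [Module (MonoidAlgebra ℚ Γ) K]
    [IsScalarTower ℚ (MonoidAlgebra ℚ Γ) K] : Representation ℚ Γ K :=
  (Algebra.lsmul ℚ ℚ K).toMonoidHom.comp (MonoidAlgebra.of ℚ Γ)

variable {Λ G : Type} [Group Λ] [Group G] (e : G ≃* Γ × Λ)
variable (K : Type) [AddCommGroup K] [Module ℚ K] [Module (MonoidAlgebra ℚ Γ) K]
    [IsScalarTower ℚ (MonoidAlgebra ℚ Γ) K]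
variable {K' : Type} [AddCommGroup K'] [Module ℚ K'] [Module (MonoidAlgebra ℚ Γ) K']
    [IsScalarTower ℚ (MonoidAlgebra ℚ Γ) K']
variable {K'' : Type} [AddCommGroup K''] [Module ℚ K''] [Module (MonoidAlgebra ℚ Γ) K'']
    [IsScalarTower ℚ (MonoidAlgebra ℚ Γ) K'']

variable {K} in
@[simp] lemma moduleRep_apply (γ : Γ) (x : K) :
    moduleRep K γ x = (MonoidAlgebra.single γ 1 : MonoidAlgebra ℚ Γ) • x := rfl

/-- The functor `Y ↦ Y ⊗ K` from representations of `Λ` to representations of `G ≃ Γ × Λ`. -/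
noncomputable def outer : Rep.{0} ℚ Λ ⥤ Rep.{0} ℚ G where
  obj Y := Rep.of (Representation.tprod (Y.ρ.comp ((MonoidHom.snd Γ Λ).comp e.toMonoidHom))
    ((moduleRep K).comp ((MonoidHom.fst Γ Λ).comp e.toMonoidHom)))
  map f := Rep.ofHom ⟨f.hom.toLinearMap.rTensor K, fun g => by
    ext y x
    simp [Rep.hom_comm_apply]⟩
  map_id Y := by
    apply Rep.hom_ext
    ext
    simp
  map_comp f f' := by
    apply Rep.hom_ext
    ext
    simp

variable {K}

@[simp] lemma outer_ρ_tmul {Y : Rep.{0} ℚ Λ} (g : G) (y : Y) (x : K) :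
    ((outer e K).obj Y).ρ g (y ⊗ₜ[ℚ] x) = Y.ρ (e g).2 y ⊗ₜ[ℚ]
      ((MonoidAlgebra.single (e g).1 1 : MonoidAlgebra ℚ Γ) • x) := rfl

lemma outer_hom_ext {Y : Rep.{0} ℚ Λ} {V : Rep.{0} ℚ G} {f f' : (outer e K).obj Y ⟶ V}
    (h : ∀ (y : Y) (x : K), f.hom (y ⊗ₜ[ℚ] x) = f'.hom (y ⊗ₜ[ℚ] x)) : f = f' := by
  apply Rep.hom_ext
  apply Representation.IntertwiningMap.ext
  exact TensorProduct.ext' h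

instance : (outer e K).Additive where
  map_add {Y Y' f f'} := by
    apply outer_hom_ext
    intro y x
    exact TensorProduct.add_tmul _ _ _

/-- Tensoring over the field ℚ is exact. -/
instance : (outer e K).PreservesHomology := by
  apply Functor.preservesHomology_of_map_exact
  intro S hS
  rw [rep_exact_iff] at hS ⊢
  exact Module.Flat.rTensor_exact K (f := S.f.hom.toLinearMap) (g := S.g.hom.toLinearMap) hS

/-- The natural transformation between the functors `outer e K` and `outer e K'` induced by a map
`K → K'`. -/
noncomputable def outerMap (u : K →ₗ[MonoidAlgebra ℚ Γ] K') : outer e K ⟶ outer e K' where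
  app Y := Rep.ofHom ⟨(u.restrictScalars ℚ).lTensor Y.V, fun g => by
    ext y x
    simp⟩
  naturality Y Y' f := by
    apply outer_hom_ext
    intro y x
    rfl

lemma outerMap_app_comp {u : K →ₗ[MonoidAlgebra ℚ Γ] K'} {v : K' →ₗ[MonoidAlgebra ℚ Γ] K''}
    (h : Function.Exact u v) (Y : Rep.{0} ℚ Λ) :
    (outerMap e u).app Y ≫ (outerMap e v).app Y = 0 := by
  apply outer_hom_ext
  intro y x
  change y ⊗ₜ[ℚ] v (u x) = 0
  rw [h.apply_apply_eq_zero, TensorProduct.tmul_zero]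

lemma outerMap_app_exact {u : K →ₗ[MonoidAlgebra ℚ Γ] K'} {v : K' →ₗ[MonoidAlgebra ℚ Γ] K''}
    (h : Function.Exact u v) (Y : Rep.{0} ℚ Λ) :
    (ShortComplex.mk _ _ (outerMap_app_comp e h Y)).Exact := by
  rw [rep_exact_iff]
  exact Module.Flat.lTensor_exact Y.V (f := u.restrictScalars ℚ) (g := v.restrictScalars ℚ) h

lemma outerMap_app_epi {u : K →ₗ[MonoidAlgebra ℚ Γ] K'} (h : Function.Surjective u)
    (Y : Rep.{0} ℚ Λ) : Epi ((outerMap e u).app Y) := by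
  rw [Rep.epi_iff_surjective]
  exact LinearMap.lTensor_surjective Y.V (g := u.restrictScalars ℚ) h

end Twist

end HigherPropertyT

/-! ### The adjunction between Y ↦ Y ⊗ ℚ[Γ]^r and V ↦ V^r -/

namespace HigherPropertyT

open TensorProduct

section Power

variable {Γ Λ G : Type} [Group Γ] [Group Λ] [Group G] (e : G ≃* Γ × Λ)

/-- The restriction to `Γ` of a representation of `G ≃ Γ × Λ`. -/
noncomputable def leftRep (V : Rep.{0} ℚ G) : Representation ℚ Γ V :=
  V.ρ.comp (e.symm.toMonoidHom.comp (MonoidHom.inl Γ Λ))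

/-- The restriction to `Λ` of a representation of `G ≃ Γ × Λ`. -/
noncomputable def rightRep (V : Rep.{0} ℚ G) : Representation ℚ Λ V :=
  V.ρ.comp (e.symm.toMonoidHom.comp (MonoidHom.inr Γ Λ))

lemma leftRep_rightRep_comm (V : Rep.{0} ℚ G) (γ : Γ) (l : Λ) (v : V) :
    leftRep e V γ (rightRep e V l v) = rightRep e V l (leftRep e V γ v) := by
  simp only [leftRep, rightRep, MonoidHom.comp_apply, ← Module.End.mul_apply, ← map_mul]
  simp

lemma ρ_eq_leftRep_rightRep (V : Rep.{0} ℚ G) (g : G) (v : V) :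
    V.ρ g v = leftRep e V (e g).1 (rightRep e V (e g).2 v) := by
  simp only [leftRep, rightRep, MonoidHom.comp_apply, ← Module.End.mul_apply, ← map_mul]
  simp

lemma leftRep_algebra_rightRep_comm (V : Rep.{0} ℚ G) (a : MonoidAlgebra ℚ Γ) (l : Λ) (v : V) :
    (leftRep e V).asAlgebraHom a (rightRep e V l v) =
      rightRep e V l ((leftRep e V).asAlgebraHom a v) := by
  induction a using MonoidAlgebra.induction_linear with
  | zero => simp
  | add f g hf hg => simp [hf, hg]
  | single γ c => simp [Representation.asAlgebraHom_single, leftRep_rightRep_comm]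

/-- The representation of `Λ` on `V^r`. -/
noncomputable def powRep (V : Rep.{0} ℚ G) (r : ℕ) : Rep.{0} ℚ Λ :=
  Rep.of (X := Fin r → V)
    { toFun l := (rightRep e V l).compLeft (Fin r)
      map_one' := by ext; simp
      map_mul' l l' := by ext; simp }

variable {e}

variable (e)

/-- The pairing `V^r × ℚ[Γ]^r → V`. -/
noncomputable def evalPow (V : Rep.{0} ℚ G) (r : ℕ) :
    (Fin r → V) →ₗ[ℚ] (Fin r → MonoidAlgebra ℚ Γ) →ₗ[ℚ] V :=
  LinearMap.mk₂ ℚ (fun v a => ∑ i, (leftRep e V).asAlgebraHom (a i) (v i))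
    (by simp [Finset.sum_add_distrib]) (by simp [Finset.smul_sum])
    (by simp [Finset.sum_add_distrib]) (by simp [Finset.smul_sum])

lemma evalPow_apply (V : Rep.{0} ℚ G) (r : ℕ) (v : Fin r → V) (a : Fin r → MonoidAlgebra ℚ Γ) :
    evalPow e V r v a = ∑ i, (leftRep e V).asAlgebraHom (a i) (v i) := rfl

lemma evalPow_smul (V : Rep.{0} ℚ G) (r : ℕ) (v : Fin r → V) (b : MonoidAlgebra ℚ Γ)
    (a : Fin r → MonoidAlgebra ℚ Γ) :
    evalPow e V r v (b • a) = (leftRep e V).asAlgebraHom b (evalPow e V r v a) := by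
  simp [evalPow_apply]

lemma evalPow_rightRep (V : Rep.{0} ℚ G) (r : ℕ) (v : Fin r → V) (l : Λ)
    (a : Fin r → MonoidAlgebra ℚ Γ) :
    evalPow e V r ((powRep e V r).ρ l v) a = rightRep e V l (evalPow e V r v a) := by
  change ∑ i, (leftRep e V).asAlgebraHom (a i) (rightRep e V l (v i)) = _
  simp [evalPow_apply, leftRep_algebra_rightRep_comm]

@[simp] lemma evalPow_single (V : Rep.{0} ℚ G) (r : ℕ) (v : Fin r → V) (i : Fin r) :
    evalPow e V r v (Pi.single i 1) = v i := by
  rw [evalPow_apply, Finset.sum_eq_single i]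
  · simp
  · intro j _ hj
    simp [Pi.single_eq_of_ne hj]
  · simp

lemma eq_evalPow (V : Rep.{0} ℚ G) (r : ℕ) (f : (Fin r → MonoidAlgebra ℚ Γ) →ₗ[ℚ] V)
    (hf : ∀ γ a, f ((MonoidAlgebra.single γ 1 : MonoidAlgebra ℚ Γ) • a) = leftRep e V γ (f a))
    (a : Fin r → MonoidAlgebra ℚ Γ) :
    evalPow e V r (fun i => f (Pi.single i 1)) a = f a := by
  have hf' : ∀ (b : MonoidAlgebra ℚ Γ) a, f (b • a) = (leftRep e V).asAlgebraHom b (f a) := by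
    intro b a
    induction b using MonoidAlgebra.induction_linear with
    | zero => simp
    | add x y hx hy => simp [add_smul, hx, hy]
    | single γ c =>
      have : (MonoidAlgebra.single γ c : MonoidAlgebra ℚ Γ) = c • MonoidAlgebra.single γ 1 := by
        simp
      rw [this, smul_assoc, map_smul, hf]
      simp [Representation.asAlgebraHom_single]
  rw [evalPow_apply]
  simp_rw [← hf']
  rw [← map_sum]
  congr 1
  ext i
  simp [Finset.sum_apply, Pi.single_apply]

/-- The map `V^r → V^s` dual to a map `ℚ[Γ]^s → ℚ[Γ]^r`. -/
noncomputable def powMap (V : Rep.{0} ℚ G) {r s : ℕ}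
    (D : (Fin s → MonoidAlgebra ℚ Γ) →ₗ[MonoidAlgebra ℚ Γ] (Fin r → MonoidAlgebra ℚ Γ)) :
    powRep e V r ⟶ powRep e V s :=
  Rep.ofHom ⟨LinearMap.pi fun j => (evalPow e V r).flip (D (Pi.single j 1)), fun l => by
    ext v j
    exact evalPow_rightRep e V r _ l _⟩

section Adjunction

variable {V : Rep.{0} ℚ G} {Y Y' : Rep.{0} ℚ Λ} {r s : ℕ}

/-- The adjunction `Hom(Y ⊗ ℚ[Γ]^r, V) → Hom(Y, V^r)`. -/
noncomputable def toPow (f : (outer e (Fin r → MonoidAlgebra ℚ Γ)).obj Y ⟶ V) :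
    Y ⟶ powRep e V r :=
  Rep.ofHom (σ := (powRep e V r).ρ)
    ⟨LinearMap.pi fun i => f.hom.toLinearMap ∘ₗ
      (TensorProduct.mk ℚ Y.V (Fin r → MonoidAlgebra ℚ Γ)).flip (Pi.single i 1), fun l => by
    refine LinearMap.ext fun y => funext fun i => ?_
    -- Elements of Λ fix the basis vectors of `ℚ[Γ]^r`, so equivariance under (1, l) gives
    -- Λ-equivariance of the coordinates.
    have h := Rep.hom_comm_apply f (e.symm (1, l)) (y ⊗ₜ[ℚ] Pi.single i 1)
    rw [outer_ρ_tmul] at h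
    simp only [MulEquiv.apply_symm_apply, ← MonoidAlgebra.one_def, one_smul] at h
    exact h⟩

/-- The adjunction `Hom(Y, V^r) → Hom(Y ⊗ ℚ[Γ]^r, V)`. -/
noncomputable def ofPow (f : Y ⟶ powRep e V r) :
    (outer e (Fin r → MonoidAlgebra ℚ Γ)).obj Y ⟶ V :=
  Rep.ofHom (ρ := ((outer e (Fin r → MonoidAlgebra ℚ Γ)).obj Y).ρ) (σ := V.ρ)
    ⟨TensorProduct.lift ((evalPow e V r) ∘ₗ f.hom.toLinearMap), fun g => by
    apply TensorProduct.ext'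
    intro y a
    change TensorProduct.lift ((evalPow e V r) ∘ₗ f.hom.toLinearMap)
      (((outer e (Fin r → MonoidAlgebra ℚ Γ)).obj Y).ρ g (y ⊗ₜ[ℚ] a)) =
      V.ρ g (evalPow e V r (f.hom y) a)
    rw [outer_ρ_tmul, TensorProduct.lift.tmul]
    change evalPow e V r (f.hom (Y.ρ (e g).2 y)) _ = _
    rw [ρ_eq_leftRep_rightRep e, Rep.hom_comm_apply f]
    refine (evalPow_smul e V r _ _ _).trans ?_
    rw [Representation.asAlgebraHom_single_one]
    exact congrArg _ (evalPow_rightRep e V r _ _ a)⟩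

lemma ofPow_tmul (f : Y ⟶ powRep e V r) (y : Y) (a : Fin r → MonoidAlgebra ℚ Γ) :
    (ofPow e f).hom (y ⊗ₜ[ℚ] a) = evalPow e V r (f.hom y) a := rfl

@[simp] lemma toPow_ofPow (f : Y ⟶ powRep e V r) : toPow e (ofPow e f) = f := by
  apply Rep.hom_ext
  apply Representation.IntertwiningMap.ext
  refine LinearMap.ext fun y => ?_
  funext i
  exact evalPow_single e V r (f.hom y) i

@[simp] lemma ofPow_toPow (f : (outer e (Fin r → MonoidAlgebra ℚ Γ)).obj Y ⟶ V) :
    ofPow e (toPow e f) = f := by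
  apply outer_hom_ext
  intro y a
  rw [ofPow_tmul]
  refine eq_evalPow e V r (f.hom.toLinearMap ∘ₗ TensorProduct.mk ℚ Y.V _ y) ?_ a
  intro γ a
  have h := Rep.hom_comm_apply f (e.symm (γ, 1)) (y ⊗ₜ[ℚ] a)
  rw [outer_ρ_tmul] at h
  simp only [MulEquiv.apply_symm_apply, map_one, Module.End.one_apply] at h
  exact h

lemma toPow_injective :
    Function.Injective (toPow e : ((outer e (Fin r → MonoidAlgebra ℚ Γ)).obj Y ⟶ V) → _) :=
  Function.LeftInverse.injective (ofPow_toPow e)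

lemma toPow_zero : toPow e (0 : (outer e (Fin r → MonoidAlgebra ℚ Γ)).obj Y ⟶ V) = 0 := rfl

lemma toPow_sub (f f' : (outer e (Fin r → MonoidAlgebra ℚ Γ)).obj Y ⟶ V) :
    toPow e (f - f') = toPow e f - toPow e f' := rfl

lemma toPow_map_comp (u : Y' ⟶ Y) (f : (outer e (Fin r → MonoidAlgebra ℚ Γ)).obj Y ⟶ V) :
    toPow e ((outer e _).map u ≫ f) = u ≫ toPow e f := rfl

/-- Naturality in the free module: pulling back along `D` on the G-side becomes a change of
coefficients on the Λ-side. -/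
lemma toPow_outerMap_comp
    (D : (Fin s → MonoidAlgebra ℚ Γ) →ₗ[MonoidAlgebra ℚ Γ] (Fin r → MonoidAlgebra ℚ Γ))
    (f : (outer e (Fin r → MonoidAlgebra ℚ Γ)).obj Y ⟶ V) :
    toPow e ((outerMap e D).app Y ≫ f) = toPow e f ≫ powMap e V D := by
  obtain ⟨f, rfl⟩ : ∃ f', f = ofPow e f' := ⟨_, (ofPow_toPow e f).symm⟩
  rw [toPow_ofPow]
  rfl

end Adjunction

/-- The map `V^r → V'^r` induced by a map `V → V'`. -/
noncomputable def powRepMap {V V' : Rep.{0} ℚ G} (w : V ⟶ V') (r : ℕ) :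
    powRep e V r ⟶ powRep e V' r :=
  Rep.ofHom ⟨w.hom.toLinearMap.compLeft (Fin r), fun l => by
    ext v i
    exact Rep.hom_comm_apply w _ _⟩

/-- The right adjoint V ↦ V^r preserves epimorphisms, so its left adjoint preserves projectives. -/
instance (r : ℕ) : (outer e (Fin r → MonoidAlgebra ℚ Γ)).PreservesProjectiveObjects where
  projective_obj {Y} _ :=
    { factors := by
        intro V V' f w hw
        have : Epi (powRepMap e w r) := by
          rw [Rep.epi_iff_surjective] at hw ⊢
          exact hw.comp_left
        refine ⟨ofPow e (Projective.factorThru (toPow e f) (powRepMap e w r)), ?_⟩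
        apply toPow_injective e
        have h : toPow e (ofPow e (Projective.factorThru (toPow e f) (powRepMap e w r)) ≫ w) =
          toPow e (ofPow e (Projective.factorThru (toPow e f) (powRepMap e w r))) ≫
            powRepMap e w r := rfl
        rw [h, toPow_ofPow, Projective.factorThru_comp] }

end Power

end HigherPropertyT

/-! ### Ext over G of T ⊗ ℚ[Γ]^r as Ext over Λ with values in V^r -/

namespace HigherPropertyT

section OuterExt

variable {Γ Λ G : Type} [Group Γ] [Group Λ] [Group G] (e : G ≃* Γ × Λ)
variable {T : Rep.{0} ℚ Λ} (R : ProjectiveResolution T) {V : Rep.{0} ℚ G} {r s t : ℕ}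

/-- The projective resolution of `T ⊗ ℚ[Γ]^r` obtained from one of `T`. -/
noncomputable abbrev outerResolution (r : ℕ) :
    ProjectiveResolution ((outer e (Fin r → MonoidAlgebra ℚ Γ)).obj T) :=
  (outer e (Fin r → MonoidAlgebra ℚ Γ)).mapProjectiveResolution R

/-- The morphism of resolutions induced by a map `ℚ[Γ]^s → ℚ[Γ]^r`. -/
noncomputable def outerResolutionMap
    (D : (Fin s → MonoidAlgebra ℚ Γ) →ₗ[MonoidAlgebra ℚ Γ] (Fin r → MonoidAlgebra ℚ Γ)) :
    ProjectiveResolution.Hom (outerResolution e R s) (outerResolution e R r)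
      ((outerMap e D).app T) where
  hom := (NatTrans.mapHomologicalComplex (outerMap e D) _).app R.complex
  hom_f_zero_comp_π_f_zero := by
    apply outer_hom_ext
    intro y a
    simp [HomologicalComplex.singleMapHomologicalComplex]
    rfl

lemma map_comp_ofPow_eq_zero {Y Y' : Rep.{0} ℚ Λ} {u : Y' ⟶ Y} {f : Y ⟶ powRep e V r}
    (hf : u ≫ f = 0) : (outer e (Fin r → MonoidAlgebra ℚ Γ)).map u ≫ ofPow e f = 0 := by
  apply toPow_injective e
  rw [toPow_map_comp, toPow_ofPow, hf, toPow_zero]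

/-- The class in `Ext(T ⊗ ℚ[Γ]^r, V)` of a cocycle with values in `V^r`. -/
noncomputable def outerExt {n : ℕ} (f : R.complex.X n ⟶ powRep e V r)
    (hf : R.complex.d (n + 1) n ≫ f = 0) :
    Abelian.Ext ((outer e (Fin r → MonoidAlgebra ℚ Γ)).obj T) V n :=
  (outerResolution e R r).extMk (ofPow e f) (n + 1) rfl (map_comp_ofPow_eq_zero e hf)

lemma outerExt_surjective {n : ℕ}
    (x : Abelian.Ext ((outer e (Fin r → MonoidAlgebra ℚ Γ)).obj T) V n) :
    ∃ (f : R.complex.X n ⟶ powRep e V r) (hf : R.complex.d (n + 1) n ≫ f = 0),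
      outerExt e R f hf = x := by
  obtain ⟨f, hf, rfl⟩ := (outerResolution e R r).extMk_surjective x (n + 1) rfl
  have hf' : R.complex.d (n + 1) n ≫ toPow e (Y := R.complex.X n) f = 0 :=
    congrArg (toPow e (Y := R.complex.X (n + 1))) hf
  refine ⟨toPow e (Y := R.complex.X n) f, hf', ?_⟩
  unfold outerExt
  congr 1
  exact ofPow_toPow e (Y := R.complex.X n) f

lemma outerExt_eq_zero_iff {n : ℕ} (f : R.complex.X (n + 1) ⟶ powRep e V r)
    (hf : R.complex.d (n + 2) (n + 1) ≫ f = 0) :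
    outerExt e R f hf = 0 ↔ ∃ g, R.complex.d (n + 1) n ≫ g = f := by
  refine ((outerResolution e R r).extMk_eq_zero_iff _ _ rfl _ n rfl).trans ⟨?_, ?_⟩
  · rintro ⟨g, hg⟩
    refine ⟨toPow e (Y := R.complex.X n) g, ?_⟩
    exact (congrArg (toPow e (Y := R.complex.X (n + 1))) hg).trans (toPow_ofPow e f)
  · rintro ⟨g, rfl⟩
    refine ⟨ofPow e g, ?_⟩
    apply toPow_injective e (Y := R.complex.X (n + 1))
    refine (toPow_map_comp e (R.complex.d (n + 1) n) (ofPow e g)).trans ?_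
    rw [toPow_ofPow, toPow_ofPow]

lemma outerExt_sub {n : ℕ} (f f' : R.complex.X n ⟶ powRep e V r)
    (hf : R.complex.d (n + 1) n ≫ f = 0) (hf' : R.complex.d (n + 1) n ≫ f' = 0) :
    outerExt e R f hf - outerExt e R f' hf' =
      outerExt e R (f - f') (by rw [Preadditive.comp_sub, hf, hf', sub_zero]) := by
  refine ((outerResolution e R r).sub_extMk _ _ _ _ _ _).trans ?_
  unfold outerExt
  congr 1
  apply toPow_injective e (Y := R.complex.X n)
  refine (toPow_sub e (ofPow e f) (ofPow e f')).trans ?_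
  rw [toPow_ofPow, toPow_ofPow, toPow_ofPow]

/-- The comparison of resolutions is the tensor product with `D` in each degree, so the adjunction
turns pullback into composition with `powMap`. -/
lemma extPullback_outerExt
    (D : (Fin s → MonoidAlgebra ℚ Γ) →ₗ[MonoidAlgebra ℚ Γ] (Fin r → MonoidAlgebra ℚ Γ)) {n : ℕ}
    (f : R.complex.X n ⟶ powRep e V r) (hf : R.complex.d (n + 1) n ≫ f = 0) :
    extPullback ((outerMap e D).app T) (outerExt e R f hf) =
      outerExt e R (f ≫ powMap e V D) (by rw [← Category.assoc, hf, Limits.zero_comp]) := by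
  refine (ProjectiveResolution.mk₀_comp_extMk _ _ _ _ (outerResolutionMap e R D)).trans ?_
  unfold outerExt
  congr 1
  apply toPow_injective e (Y := R.complex.X n)
  refine (toPow_outerMap_comp e D (ofPow e f)).trans ?_
  rw [toPow_ofPow, toPow_ofPow]

include R

lemma ext_outer_eq_zero {j : ℕ} (h : ∀ x : Abelian.Ext T (powRep e V r) j, x = 0)
    (x : Abelian.Ext ((outer e (Fin r → MonoidAlgebra ℚ Γ)).obj T) V j) : x = 0 := by
  rcases j with _ | j
  · obtain ⟨u, rfl⟩ := Abelian.Ext.addEquiv₀.symm.surjective x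
    have h0 : toPow e u = 0 := (Abelian.Ext.mk₀_eq_zero_iff _).1 (h _)
    have : u = 0 := toPow_injective e (h0.trans (toPow_zero e).symm)
    rw [this, map_zero]
  · obtain ⟨f, hf, rfl⟩ := outerExt_surjective e R x
    exact (outerExt_eq_zero_iff e R f hf).2 ((R.extMk_eq_zero_iff f (j + 2) rfl hf j rfl).1 (h _))

/-- A Λ-equivariant homotopy acts on cocycles. If `f` is a cocycle with `f ≫ powMap e V D' = d ≫ g`,
then `f - f ≫ h ≫ powMap e V D` is the coboundary of `g ≫ h'`. -/
lemma ext_outer_exact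
    (D : (Fin s → MonoidAlgebra ℚ Γ) →ₗ[MonoidAlgebra ℚ Γ] (Fin r → MonoidAlgebra ℚ Γ))
    (D' : (Fin t → MonoidAlgebra ℚ Γ) →ₗ[MonoidAlgebra ℚ Γ] (Fin s → MonoidAlgebra ℚ Γ))
    (h : powRep e V s ⟶ powRep e V r) (h' : powRep e V t ⟶ powRep e V s)
    (hh : powMap e V D' ≫ h' + h ≫ powMap e V D = 𝟙 _) {j : ℕ}
    (x : Abelian.Ext ((outer e (Fin s → MonoidAlgebra ℚ Γ)).obj T) V (j + 1))
    (hx : extPullback ((outerMap e D').app T) x = 0) :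
    ∃ y : Abelian.Ext ((outer e (Fin r → MonoidAlgebra ℚ Γ)).obj T) V (j + 1),
      extPullback ((outerMap e D).app T) y = x := by
  obtain ⟨f, hf, rfl⟩ := outerExt_surjective e R x
  refine ⟨outerExt e R (f ≫ h) (by rw [← Category.assoc, hf, Limits.zero_comp]), ?_⟩
  rw [extPullback_outerExt, outerExt_eq_zero_iff] at hx
  obtain ⟨g, hg⟩ := hx
  rw [← sub_eq_zero, extPullback_outerExt, outerExt_sub, outerExt_eq_zero_iff]
  refine ⟨-(g ≫ h'), ?_⟩
  rw [Preadditive.comp_neg, ← Category.assoc, hg, eq_sub_iff_add_eq,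
    Category.assoc, Category.assoc]
  nth_rewrite 2 [← Category.comp_id f]
  rw [← hh, Preadditive.comp_add]
  abel

/-- The left end of the complex: `ext_outer_exact` with zero as the incoming differential. -/
lemma ext_outer_injective
    (D' : (Fin t → MonoidAlgebra ℚ Γ) →ₗ[MonoidAlgebra ℚ Γ] (Fin s → MonoidAlgebra ℚ Γ))
    (h' : powRep e V t ⟶ powRep e V s) (hh : powMap e V D' ≫ h' = 𝟙 _) {j : ℕ}
    (x : Abelian.Ext ((outer e (Fin s → MonoidAlgebra ℚ Γ)).obj T) V (j + 1))
    (hx : extPullback ((outerMap e D').app T) x = 0) : x = 0 := by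
  obtain ⟨y, rfl⟩ := ext_outer_exact e R (r := s) 0 D' 0 h' (by simpa using hh) x hx
  have : (outerMap e (0 : (Fin s → MonoidAlgebra ℚ Γ) →ₗ[MonoidAlgebra ℚ Γ]
      (Fin s → MonoidAlgebra ℚ Γ))).app T = 0 := by
    apply outer_hom_ext
    intro y a
    exact TensorProduct.tmul_zero _ _
  rw [this, extPullback_zero_left]

end OuterExt

/-! ### The augmented complex and its two uses -/

section Complex

variable {Γ Λ G : Type} [Group Γ] [Group Λ] [Group G] (e : G ≃* Γ × Λ)
variable {K : Type} [AddCommGroup K] [Module ℚ K] [Module (MonoidAlgebra ℚ Γ) K]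
    [IsScalarTower ℚ (MonoidAlgebra ℚ Γ) K]
variable {r : ℕ → ℕ}
    (D : ∀ q, (Fin (r (q + 1)) → MonoidAlgebra ℚ Γ) →ₗ[MonoidAlgebra ℚ Γ]
      (Fin (r q) → MonoidAlgebra ℚ Γ))
    (ε : (Fin (r 0) → MonoidAlgebra ℚ Γ) →ₗ[MonoidAlgebra ℚ Γ] K)
    (T : Rep.{0} ℚ Λ)

/-- The objects of the augmented complex `T ⊗ ℚ[Γ]^(r •) → T ⊗ K`. -/
noncomputable def augObj (K : Type) [AddCommGroup K] [Module ℚ K] [Module (MonoidAlgebra ℚ Γ) K]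
    [IsScalarTower ℚ (MonoidAlgebra ℚ Γ) K] (r : ℕ → ℕ) (T : Rep.{0} ℚ Λ) : ℕ → Rep.{0} ℚ G
  | 0 => (outer e K).obj T
  | q + 1 => (outer e (Fin (r q) → MonoidAlgebra ℚ Γ)).obj T

/-- The differentials of the augmented complex `T ⊗ ℚ[Γ]^(r •) → T ⊗ K`. -/
noncomputable def augMap : ∀ q, augObj e K r T (q + 1) ⟶ augObj e K r T q
  | 0 => (outerMap e ε).app T
  | q + 1 => (outerMap e (D q)).app T

variable {D ε} {N : ℕ} (hε : Function.Surjective ε) (h0 : Function.Exact (D 0) ε)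
  (hD : ∀ q, q + 1 < N → Function.Exact (D (q + 1)) (D q))

include hε in
lemma augMap_zero_epi : Epi (augMap e D ε T 0) := outerMap_app_epi e hε T

include h0 hD

lemma augMap_comp : ∀ q < N, augMap e D ε T (q + 1) ≫ augMap e D ε T q = 0
  | 0, _ => outerMap_app_comp e h0 T
  | q + 1, hq => outerMap_app_comp e (hD q hq) T

lemma augMap_exact : ∀ q (hq : q < N),
    (ShortComplex.mk _ _ (augMap_comp e T h0 hD q hq)).Exact
  | 0, _ => outerMap_app_exact e h0 T
  | q + 1, hq => outerMap_app_exact e (hD q hq) T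

include hε

/-- Vanishing of `Ext(T ⊗ K, V)` from a partial contraction of the complex `V^(r •)`. -/
theorem ext_outer_vanish {V : Rep.{0} ℚ G} {n m : ℕ} (hN : n + m + 1 ≤ N)
    (h1 : ∀ q j, j ≤ m → ∀ x : Abelian.Ext T (powRep e V (r q)) j, x = 0)
    (h : ∀ q, powRep e V (r (q + 1)) ⟶ powRep e V (r q))
    (hh0 : powMap e V (D 0) ≫ h 0 = 𝟙 _)
    (hh : ∀ q, q + 1 ≤ n → powMap e V (D (q + 1)) ≫ h (q + 1) + h q ≫ powMap e V (D q) = 𝟙 _)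
    (k : ℕ) (hk : k ≤ n + m + 1) (x : Abelian.Ext ((outer e K).obj T) V k) : x = 0 := by
  let R := projectiveResolution T
  have := augMap_zero_epi (D := D) e T hε
  have hv : ∀ q j, j ≤ m → ∀ x : Abelian.Ext (augObj e K r T (q + 1)) V j, x = 0 :=
    fun q j hj => ext_outer_eq_zero e R (h1 q j hj)
  refine ext_eq_zero_of_exact (augMap_comp e T h0 hD) (augMap_exact e T h0 hD) hN
    (fun q j hj _ => hv q j hj) ?_ ?_ k hk x
  · intro q j hq x hx
    -- `ext_outer_exact` covers positive degrees; degree 0 is within the range `j ≤ m` of vanishing.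
    rcases j with _ | j
    · exact ⟨0, by rw [hv (q + 1) 0 (by omega) x, extPullback_zero]⟩
    · exact ext_outer_exact e R (D q) (D (q + 1)) (h q) (h (q + 1)) (hh q hq) x hx
  · intro j x hx
    rcases j with _ | j
    · exact hv 0 0 (by omega) x
    · exact ext_outer_injective e R (D 0) (h 0) hh0 x hx

/-- Vanishing of `Ext(T ⊗ K, V)` implies the exactness of the complex `V^(r •)` when `T` is
projective. -/
theorem hom_outer_exact [Projective T] {V : Rep.{0} ℚ G} {n : ℕ} (hN : n + 1 ≤ N)
    (hV : ∀ j ≤ n, ∀ x : Abelian.Ext ((outer e K).obj T) V j, x = 0) :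
    (∀ f : T ⟶ powRep e V (r 0), f ≫ powMap e V (D 0) = 0 → f = 0) ∧
    ∀ q, q + 1 ≤ n → ∀ f : T ⟶ powRep e V (r (q + 1)), f ≫ powMap e V (D (q + 1)) = 0 →
      ∃ f' : T ⟶ powRep e V (r q), f' ≫ powMap e V (D q) = f := by
  have := augMap_zero_epi (D := D) e T hε
  have : ∀ q, Projective (augObj e K r T (q + 1)) := fun q =>
    Functor.PreservesProjectiveObjects.projective_obj
      (F := outer e (Fin (r q) → MonoidAlgebra ℚ Γ)) inferInstance
  obtain ⟨ha, hb⟩ := hom_exact_of_ext_eq_zero (augMap_comp e T h0 hD) (augMap_exact e T h0 hD) hN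
    (Y := V) hV
  constructor
  · intro f hf
    rw [← toPow_ofPow e f, ← toPow_outerMap_comp] at hf
    have := ha (ofPow e f) (toPow_injective e (hf.trans (toPow_zero e).symm))
    rw [← toPow_ofPow e f, this]
    rfl
  · intro q hq f hf
    rw [← toPow_ofPow e f, ← toPow_outerMap_comp] at hf
    obtain ⟨f', hf'⟩ := hb q hq (ofPow e f) (toPow_injective e (hf.trans (toPow_zero e).symm))
    refine ⟨toPow e (Y := T) f', ?_⟩
    refine (toPow_outerMap_comp e (D q) (Y := T) f').symm.trans ?_
    exact (congrArg (toPow e (Y := T)) hf').trans (toPow_ofPow e f)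

end Complex

end HigherPropertyT

/-! ### Group cohomology as Ext, over ℂ and over ℚ -/

namespace HigherPropertyT

section GroupCohomology

lemma subsingleton_homology_iff {k : Type} [CommRing k] (K : CochainComplex (ModuleCat.{0} k) ℕ)
    (i : ℕ) : Subsingleton (K.homology (i + 1)) ↔
      ∀ f : K.X (i + 1), K.d (i + 1) (i + 2) f = 0 → ∃ g : K.X i, K.d i (i + 1) g = f := by
  rw [← ModuleCat.isZero_iff_subsingleton, ← HomologicalComplex.exactAt_iff_isZero_homology,
    HomologicalComplex.exactAt_iff' K i (i + 1) (i + 2) (by simp) (by simp),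
    ShortComplex.moduleCat_exact_iff]
  exact Iff.rfl

variable {k G : Type} [CommRing k] [Group G] (A : Rep.{0} k G)

lemma subsingleton_groupCohomology_iff (i : ℕ) : Subsingleton (groupCohomology A (i + 1)) ↔
    ∀ f : (Fin (i + 1) → G) → A, inhomogeneousCochains.d A (i + 1) f = 0 →
      ∃ g : (Fin i → G) → A, inhomogeneousCochains.d A i g = f := by
  refine (subsingleton_homology_iff (groupCohomology.inhomogeneousCochains A) i).trans ?_
  rw [groupCohomology.inhomogeneousCochains.d_def, groupCohomology.inhomogeneousCochains.d_def]

/-- Both sides say that every cocycle in Hom(bar resolution, `A`) is a coboundary. -/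
lemma subsingleton_groupCohomology_iff_ext (i : ℕ) :
    Subsingleton (groupCohomology A (i + 1)) ↔
      ∀ x : Abelian.Ext (Rep.trivial k G k) A (i + 1), x = 0 := by
  let R := Rep.barResolution k G
  have h1 : Subsingleton (groupCohomology A (i + 1)) ↔
      Subsingleton ((R.complex.linearYonedaObj k A).homology (i + 1)) :=
    (groupCohomologyIso A (i + 1) R).toLinearEquiv.toEquiv.subsingleton_congr
  rw [h1, subsingleton_homology_iff]
  constructor
  · intro h x
    obtain ⟨f, hf, rfl⟩ := R.extMk_surjective x (i + 2) rfl
    exact (R.extMk_eq_zero_iff f (i + 2) rfl hf i rfl).2 (h f hf)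
  · intro h f hf
    exact (R.extMk_eq_zero_iff f (i + 2) rfl hf i rfl).1 (h _)

/-- The underlying rational representation of a complex one. -/
noncomputable def ratRep (A : Rep.{0} ℂ G) : Rep.{0} ℚ G :=
  letI : Module ℚ A := Module.compHom A (algebraMap ℚ ℂ)
  haveI : IsScalarTower ℚ ℂ A := ⟨fun q z v => by
    rw [Algebra.smul_def, mul_smul]; rfl⟩
  Rep.of (X := A)
    { toFun g := (A.ρ g).restrictScalars ℚ
      map_one' := by ext; simp
      map_mul' g h := by ext; simp }

variable {A}

lemma ratRep_smul (A : Rep.{0} ℂ G) (q : ℚ) (v : ratRep A) :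
    q • v = ((q : ℂ) • (show A from v) : A) := rfl

/-- The differential involves only the action and integral signs. Cocycles and coboundaries are
therefore the same sets over ℚ and ℂ, and vanishing transfers both ways. -/
lemma inhomogeneousCochains_d_ratRep (A : Rep.{0} ℂ G) (i : ℕ) (f : (Fin i → G) → A) :
    inhomogeneousCochains.d (ratRep A) i f = inhomogeneousCochains.d A i f := by
  funext g
  rw [inhomogeneousCochains.d_hom_apply]
  refine Eq.trans ?_ (inhomogeneousCochains.d_hom_apply A i f g).symm
  refine congrArg₂ (fun a b : A => a + b) rfl (Finset.sum_congr rfl fun j _ => ?_)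
  refine (ratRep_smul A _ _).trans ?_
  push_cast
  rfl

lemma ext_ratRep_eq_zero {A : Rep.{0} ℂ G} {i : ℕ} (h : Subsingleton (groupCohomology A (i + 1)))
    (x : Abelian.Ext (Rep.trivial ℚ G ℚ) (ratRep A) (i + 1)) : x = 0 := by
  refine (subsingleton_groupCohomology_iff_ext (ratRep A) i).1 ?_ x
  rw [subsingleton_groupCohomology_iff] at h ⊢
  intro f hf
  obtain ⟨g, hg⟩ := h f ((inhomogeneousCochains_d_ratRep A (i + 1) f).symm.trans hf)
  exact ⟨g, (inhomogeneousCochains_d_ratRep A i g).trans hg⟩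

lemma subsingleton_groupCohomology_of_ratRep {A : Rep.{0} ℂ G} {i : ℕ}
    (h : ∀ x : Abelian.Ext (Rep.trivial ℚ G ℚ) (ratRep A) (i + 1), x = 0) :
    Subsingleton (groupCohomology A (i + 1)) := by
  rw [← subsingleton_groupCohomology_iff_ext, subsingleton_groupCohomology_iff] at h
  rw [subsingleton_groupCohomology_iff]
  intro f hf
  obtain ⟨g, hg⟩ := h f ((inhomogeneousCochains_d_ratRep A (i + 1) f).trans hf)
  exact ⟨g, (inhomogeneousCochains_d_ratRep A i g).symm.trans hg⟩

lemma ext_zero_trivial_eq_zero {A : Rep.{0} ℚ G} (h : ∀ v : A, (∀ g, A.ρ g v = v) → v = 0)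
    (x : Abelian.Ext (Rep.trivial ℚ G ℚ) A 0) : x = 0 := by
  obtain ⟨u, rfl⟩ := Abelian.Ext.addEquiv₀.symm.surjective x
  have h1 : u.hom (1 : ℚ) = 0 := h _ fun g => (Rep.hom_comm_apply u g (1 : ℚ)).symm
  have : u = 0 := by
    apply Rep.hom_ext
    apply Representation.IntertwiningMap.ext
    exact LinearMap.ext_ring h1
  rw [this, map_zero]

lemma subsingleton_groupCohomology_zero (h : ∀ v : A, (∀ g, A.ρ g v = v) → v = 0) :
    Subsingleton (groupCohomology A 0) := by
  rw [(groupCohomology.H0Iso A).toLinearEquiv.toEquiv.subsingleton_congr]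
  refine ⟨fun x y => ?_⟩
  rw [Subtype.ext_iff, h x.1 x.2, h y.1 y.2]

end GroupCohomology

end HigherPropertyT

/-! ### Moore–Penrose pseudoinverses and closed range -/

namespace HigherPropertyT

section Pseudoinverse

open Filter Topology

variable {E F F' : Type} [NormedAddCommGroup E] [InnerProductSpace ℂ E] [CompleteSpace E]
  [NormedAddCommGroup F] [InnerProductSpace ℂ F] [CompleteSpace F]
  [NormedAddCommGroup F'] [InnerProductSpace ℂ F'] [CompleteSpace F']

/-- `S` is the Moore–Penrose pseudoinverse of `T`. -/
def IsPseudoinverse (T : E →L[ℂ] F) (S : F →ₗ[ℂ] E) : Prop :=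
  ∀ y, S y ∈ (LinearMap.ker T.toLinearMap)ᗮ ∧ y - T (S y) ∈ (LinearMap.range T.toLinearMap)ᗮ

omit [CompleteSpace E] [CompleteSpace F] in
-- Uniqueness of the least-squares solution of minimal norm; linearity and equivariance of the
-- pseudoinverse both follow from it.
lemma eq_of_mem_ker_orthogonal {T : E →L[ℂ] F} {x x' : E} {y : F}
    (hx : x ∈ (LinearMap.ker T.toLinearMap)ᗮ) (hx' : x' ∈ (LinearMap.ker T.toLinearMap)ᗮ)
    (hy : y - T x ∈ (LinearMap.range T.toLinearMap)ᗮ)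
    (hy' : y - T x' ∈ (LinearMap.range T.toLinearMap)ᗮ) : x = x' := by
  have h1 : T (x - x') = 0 := by
    have h : T (x - x') ∈ (LinearMap.range T.toLinearMap)ᗮ := by
      have := Submodule.sub_mem _ hy' hy
      rwa [sub_sub_sub_cancel_left, ← map_sub] at this
    exact inner_self_eq_zero.1 (h _ ⟨x - x', rfl⟩)
  have h2 : x - x' ∈ (LinearMap.ker T.toLinearMap)ᗮ := Submodule.sub_mem _ hx hx'
  exact sub_eq_zero.1 (inner_self_eq_zero.1 (h2 _ h1))

lemma exists_isPseudoinverse (T : E →L[ℂ] F) (hT : IsClosed (Set.range T)) :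
    ∃ S, IsPseudoinverse T S := by
  have : CompleteSpace (LinearMap.range T.toLinearMap) := hT.completeSpace_coe
  have : CompleteSpace (LinearMap.ker T.toLinearMap) :=
    (ContinuousLinearMap.isClosed_ker T).completeSpace_coe
  have hex : ∀ y, ∃ x, x ∈ (LinearMap.ker T.toLinearMap)ᗮ ∧
      y - T x ∈ (LinearMap.range T.toLinearMap)ᗮ := by
    intro y
    obtain ⟨_, ⟨z, rfl⟩, u, hu, hy⟩ :=
      Submodule.exists_add_mem_mem_orthogonal (K := LinearMap.range T.toLinearMap) y
    obtain ⟨a, ha, b, hb, hz⟩ :=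
      Submodule.exists_add_mem_mem_orthogonal (K := LinearMap.ker T.toLinearMap) z
    refine ⟨b, hb, ?_⟩
    have ha' : T a = 0 := ha
    have : y - T b = u := by
      rw [hy, hz]
      simp [ha']
    rwa [this]
  choose S hS hS' using hex
  refine ⟨{ toFun := S, map_add' := fun y y' => ?_, map_smul' := fun c y => ?_ },
    fun y => ⟨hS y, hS' y⟩⟩
  · refine eq_of_mem_ker_orthogonal (hS _) (Submodule.add_mem _ (hS y) (hS y')) (hS' _) ?_
    rw [map_add, add_sub_add_comm]
    exact Submodule.add_mem _ (hS' y) (hS' y')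
  · refine eq_of_mem_ker_orthogonal (hS _) (Submodule.smul_mem _ c (hS y)) (hS' _) ?_
    rw [map_smul, RingHom.id_apply, ← smul_sub]
    exact Submodule.smul_mem _ c (hS' y)

omit [CompleteSpace E] [CompleteSpace F] in
lemma IsPseudoinverse.apply_apply {T : E →L[ℂ] F} {S : F →ₗ[ℂ] E} (h : IsPseudoinverse T S)
    (x : E) : T (S (T x)) = T x := by
  have h1 := (h (T x)).2
  rw [← map_sub] at h1
  have h2 : T (x - S (T x)) = 0 := inner_self_eq_zero.1 (h1 _ ⟨x - S (T x), rfl⟩)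
  rw [map_sub, sub_eq_zero] at h2
  exact h2.symm

omit [CompleteSpace E] [CompleteSpace F] [CompleteSpace F'] in
-- The defect `x - S' (T' x) - T (S x)` lies both in `ker T' = range T` and in its orthogonal
-- complement.
lemma IsPseudoinverse.add_eq {T : E →L[ℂ] F} {S : F →ₗ[ℂ] E} {T' : F →L[ℂ] F'} {S' : F' →ₗ[ℂ] F}
    (h : IsPseudoinverse T S) (h' : IsPseudoinverse T' S')
    (hT : ∀ x, T' x = 0 ↔ ∃ y, T y = x) (x : F) : S' (T' x) + T (S x) = x := by
  have h1 : x - S' (T' x) - T (S x) ∈ LinearMap.ker T'.toLinearMap := by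
    refine Submodule.sub_mem _ ?_ ((hT _).2 ⟨_, rfl⟩)
    change T' (x - S' (T' x)) = 0
    rw [map_sub, h'.apply_apply, sub_self]
  have h2 : x - S' (T' x) - T (S x) ∈ (LinearMap.ker T'.toLinearMap)ᗮ := by
    rw [sub_right_comm]
    refine Submodule.sub_mem _ ?_ (h' _).1
    have : LinearMap.ker T'.toLinearMap = LinearMap.range T.toLinearMap := by
      ext z
      exact hT z
    rw [this]
    exact (h x).2
  have h3 := inner_self_eq_zero.1 (h2 _ h1)
  rw [sub_sub, sub_eq_zero] at h3
  exact h3.symm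

omit [CompleteSpace E] [CompleteSpace F] in
/-- The pseudoinverse of an operator commutes with everything that commutes with the operator
together with the adjoints. -/
lemma IsPseudoinverse.comm {T : E →L[ℂ] F} {S : F →ₗ[ℂ] E} (h : IsPseudoinverse T S)
    {A A' : E →L[ℂ] E} {B B' : F →L[ℂ] F} (hA : ∀ x y, inner ℂ (A' x) y = inner ℂ x (A y))
    (hB : ∀ x y, inner ℂ (B' x) y = inner ℂ x (B y)) (hT : ∀ x, T (A x) = B (T x))
    (hT' : ∀ x, T (A' x) = B' (T x)) (y : F) : S (B y) = A (S y) := by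
  -- `A'` preserves the kernel and `B'` the range, so their adjoints `A` and `B` preserve the
  -- orthogonal complements; uniqueness concludes.
  refine eq_of_mem_ker_orthogonal (h _).1 ?_ (h _).2 ?_
  · intro z hz
    rw [← hA]
    refine (h y).1 _ ?_
    have hz' : T z = 0 := hz
    change T (A' z) = 0
    rw [hT', hz', map_zero]
  · rw [hT, ← map_sub]
    rintro _ ⟨z, rfl⟩
    rw [← hB]
    refine (h y).2 _ ⟨A' z, hT' z⟩

omit [CompleteSpace F] in
-- Restricted to the complement of its kernel, `T` keeps its range and becomes antilipschitz on a
-- complete space.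
lemma isClosed_range_of_bound (T : E →L[ℂ] F) {c : ℝ} (hc : 0 < c)
    (h : ∀ x ∈ (LinearMap.ker T.toLinearMap)ᗮ, c * ‖x‖ ≤ ‖T x‖) : IsClosed (Set.range T) := by
  have : CompleteSpace (LinearMap.ker T.toLinearMap) :=
    (ContinuousLinearMap.isClosed_ker T).completeSpace_coe
  have : CompleteSpace ((LinearMap.ker T.toLinearMap)ᗮ : Submodule ℂ E) :=
    (Submodule.isClosed_orthogonal _).completeSpace_coe
  let T' : ((LinearMap.ker T.toLinearMap)ᗮ : Submodule ℂ E) →L[ℂ] F :=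
    T.comp (Submodule.subtypeL _)
  have hanti : AntilipschitzWith (Real.toNNReal c⁻¹) T' := by
    refine ContinuousLinearMap.antilipschitz_of_bound T' fun x => ?_
    rw [Real.coe_toNNReal _ (inv_nonneg.2 hc.le), ← div_eq_inv_mul, le_div_iff₀' hc]
    exact h x x.2
  have hr : Set.range T = Set.range T' := by
    ext y
    constructor
    · rintro ⟨x, rfl⟩
      obtain ⟨a, ha, b, hb, rfl⟩ :=
        Submodule.exists_add_mem_mem_orthogonal (K := LinearMap.ker T.toLinearMap) x
      have ha' : T a = 0 := ha
      exact ⟨⟨b, hb⟩, by simp [T', ha']⟩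
    · rintro ⟨x, rfl⟩
      exact ⟨x, rfl⟩
  rw [hr]
  exact hanti.isClosed_range T'.uniformContinuous

omit [CompleteSpace F] in
lemma exists_seq_of_not_isClosed_range (T : E →L[ℂ] F) (h : ¬ IsClosed (Set.range T)) :
    ∃ x : ℕ → E, (∀ i, x i ∈ (LinearMap.ker T.toLinearMap)ᗮ) ∧ (∀ i, ‖x i‖ = 1) ∧
      Tendsto (fun i => ‖T (x i)‖) atTop (𝓝 0) := by
  have hx : ∀ i : ℕ, ∃ x ∈ (LinearMap.ker T.toLinearMap)ᗮ, ‖x‖ = 1 ∧ ‖T x‖ ≤ 1 / ((i : ℝ) + 1) := by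
    intro i
    by_contra! hcon
    refine h (isClosed_range_of_bound T (c := 1 / ((i : ℝ) + 1)) (by positivity) fun x hx => ?_)
    by_cases hx0 : x = 0
    · simp [hx0]
    have hn : ‖x‖ ≠ 0 := norm_ne_zero_iff.2 hx0
    have := hcon (((‖x‖⁻¹ : ℝ) : ℂ) • x) (Submodule.smul_mem _ _ hx)
      (by rw [norm_smul]; simp [hn])
    rw [map_smul, norm_smul] at this
    simp only [Complex.norm_real, norm_inv, norm_norm] at this
    rw [← div_eq_inv_mul, lt_div_iff₀ (by positivity)] at this
    exact this.le
  choose x h1 h2 h3 using hx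
  refine ⟨x, h1, h2, ?_⟩
  exact squeeze_zero (fun _ => norm_nonneg _) h3 tendsto_one_div_add_atTop_nhds_zero_nat

end Pseudoinverse

end HigherPropertyT

/-! ### Matrices over ℚ[Γ] acting on complex representations -/

namespace HigherPropertyT

section RationalOperators

variable {Γ V V' : Type} [Group Γ] [AddCommGroup V] [Module ℂ V] [AddCommGroup V'] [Module ℂ V']
  {r s t : ℕ}

/-- The action of `ℚ[Γ]` on a complex representation of `Γ`. -/
noncomputable def ratAct (ρ : Representation ℂ Γ V) : MonoidAlgebra ℚ Γ →+* Module.End ℂ V :=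
  (ρ.asAlgebraHom : MonoidAlgebra ℂ Γ →+* Module.End ℂ V).comp
    (MonoidAlgebra.mapRingHom Γ (algebraMap ℚ ℂ))

lemma ratAct_single (ρ : Representation ℂ Γ V) (γ : Γ) (c : ℚ) :
    ratAct ρ (MonoidAlgebra.single γ c) = (c : ℂ) • ρ γ := by
  simp [ratAct, Representation.asAlgebraHom_single]

lemma map_ratAct {ρ : Representation ℂ Γ V} {ρ' : Representation ℂ Γ V'} (T : V →ₗ[ℂ] V')
    (hT : ∀ γ x, T (ρ γ x) = ρ' γ (T x)) (b : MonoidAlgebra ℚ Γ) (x : V) :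
    T (ratAct ρ b x) = ratAct ρ' b (T x) := by
  induction b using MonoidAlgebra.induction_linear with
  | zero => simp
  | add f g hf hg => simp [hf, hg]
  | single γ c => simp [ratAct_single, hT]

/-- The pairing `V^r × ℚ[Γ]^r → V`. -/
noncomputable def ratEval (ρ : Representation ℂ Γ V) (a : Fin r → MonoidAlgebra ℚ Γ) :
    (Fin r → V) →ₗ[ℂ] V :=
  ∑ i, ratAct ρ (a i) ∘ₗ LinearMap.proj i

lemma ratEval_apply (ρ : Representation ℂ Γ V) (a : Fin r → MonoidAlgebra ℚ Γ) (v : Fin r → V) :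
    ratEval ρ a v = ∑ i, ratAct ρ (a i) (v i) := by
  simp [ratEval]

lemma ratEval_zero (ρ : Representation ℂ Γ V) :
    ratEval ρ (0 : Fin r → MonoidAlgebra ℚ Γ) = 0 := by
  simp [ratEval]

lemma ratEval_sum_smul (ρ : Representation ℂ Γ V) (b : Fin s → MonoidAlgebra ℚ Γ)
    (a : Fin s → Fin r → MonoidAlgebra ℚ Γ) (v : Fin r → V) :
    ratEval ρ (∑ j, b j • a j) v = ∑ j, ratAct ρ (b j) (ratEval ρ (a j) v) := by
  simp only [ratEval_apply, Finset.sum_apply, Pi.smul_apply, smul_eq_mul, map_sum, map_mul,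
    LinearMap.sum_apply, Module.End.mul_apply]
  exact Finset.sum_comm

/-- The map `V^r → V^s` dual to a map `ℚ[Γ]^s → ℚ[Γ]^r`. -/
noncomputable def ratMat (ρ : Representation ℂ Γ V)
    (D : (Fin s → MonoidAlgebra ℚ Γ) →ₗ[MonoidAlgebra ℚ Γ] (Fin r → MonoidAlgebra ℚ Γ)) :
    (Fin r → V) →ₗ[ℂ] (Fin s → V) :=
  LinearMap.pi fun j => ratEval ρ (D (Pi.single j 1))

lemma ratMat_apply (ρ : Representation ℂ Γ V)
    (D : (Fin s → MonoidAlgebra ℚ Γ) →ₗ[MonoidAlgebra ℚ Γ] (Fin r → MonoidAlgebra ℚ Γ))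
    (v : Fin r → V) (j : Fin s) :
    ratMat ρ D v j = ∑ i, ratAct ρ (D (Pi.single j 1) i) (v i) :=
  ratEval_apply ρ _ v

lemma ratMat_ratMat (ρ : Representation ℂ Γ V)
    {D : (Fin s → MonoidAlgebra ℚ Γ) →ₗ[MonoidAlgebra ℚ Γ] (Fin r → MonoidAlgebra ℚ Γ)}
    {D' : (Fin t → MonoidAlgebra ℚ Γ) →ₗ[MonoidAlgebra ℚ Γ] (Fin s → MonoidAlgebra ℚ Γ)}
    (h : ∀ x, D (D' x) = 0) (v : Fin r → V) : ratMat ρ D' (ratMat ρ D v) = 0 := by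
  funext j
  have h1 : ∑ i, D' (Pi.single j 1) i • D (Pi.single i 1) = 0 := by
    rw [← h (Pi.single j 1)]
    simp only [← map_smul, ← map_sum]
    congr 1
    ext i
    simp [Finset.sum_apply, Pi.single_apply]
  rw [ratMat_apply]
  change ∑ i, ratAct ρ (D' (Pi.single j 1) i) (ratEval ρ (D (Pi.single i 1)) v) = 0
  rw [← ratEval_sum_smul, h1, ratEval_zero, LinearMap.zero_apply]

/-- Applied below to evaluation of sequences, to the embedding into the completion, and to the
operators of Λ. -/
lemma map_ratMat {ρ : Representation ℂ Γ V} {ρ' : Representation ℂ Γ V'} (T : V →ₗ[ℂ] V')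
    (hT : ∀ γ x, T (ρ γ x) = ρ' γ (T x))
    (D : (Fin s → MonoidAlgebra ℚ Γ) →ₗ[MonoidAlgebra ℚ Γ] (Fin r → MonoidAlgebra ℚ Γ))
    (v : Fin r → V) (j : Fin s) :
    T (ratMat ρ D v j) = ratMat ρ' D (fun i => T (v i)) j := by
  simp [ratMat_apply, map_ratAct T hT]

end RationalOperators

/-! ### Bounded operators and unitary powers -/

section UnitaryOperators

variable {Γ V : Type} [Group Γ] [NormedAddCommGroup V] [InnerProductSpace ℂ V] [CompleteSpace V]
  (π : Γ →* unitary (V →L[ℂ] V)) {r s : ℕ}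

lemma continuous_ratAct (b : MonoidAlgebra ℚ Γ) : Continuous (ratAct (toRep π) b) := by
  induction b using MonoidAlgebra.induction_linear with
  | zero =>
    rw [map_zero]
    exact continuous_zero
  | add f g hf hg =>
    rw [map_add]
    exact hf.add hg
  | single γ c =>
    rw [ratAct_single]
    exact (π γ : V →L[ℂ] V).continuous.const_smul (c : ℂ)

/-- The bounded operator `V^r → V^s` dual to a map `ℚ[Γ]^s → ℚ[Γ]^r`. -/
noncomputable def ratOp
    (D : (Fin s → MonoidAlgebra ℚ Γ) →ₗ[MonoidAlgebra ℚ Γ] (Fin r → MonoidAlgebra ℚ Γ)) :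
    PiLp 2 (fun _ : Fin r => V) →L[ℂ] PiLp 2 (fun _ : Fin s => V) where
  toLinearMap := (WithLp.linearEquiv 2 ℂ (Fin s → V)).symm.toLinearMap ∘ₗ
    ratMat (toRep π) D ∘ₗ (WithLp.linearEquiv 2 ℂ (Fin r → V)).toLinearMap
  cont := by
    have h : Continuous (ratMat (toRep π) D) := by
      refine continuous_pi fun j => ?_
      simp only [ratMat_apply]
      exact continuous_finsetSum _ fun i _ => (continuous_ratAct π _).comp (continuous_apply i)
    exact (PiLp.continuous_toLp 2 _).comp (h.comp (PiLp.continuous_ofLp 2 _))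

lemma ratOp_apply
    (D : (Fin s → MonoidAlgebra ℚ Γ) →ₗ[MonoidAlgebra ℚ Γ] (Fin r → MonoidAlgebra ℚ Γ))
    (v : PiLp 2 (fun _ : Fin r => V)) :
    ratOp π D v = WithLp.toLp 2 (ratMat (toRep π) D (WithLp.ofLp v)) := rfl

/-- A homomorphism into isometric operators defines a unitary representation. -/
noncomputable def unitaryOfIsometric (φ : Γ →* (V →L[ℂ] V)) (h : ∀ γ x, ‖φ γ x‖ = ‖x‖) :
    Γ →* unitary (V →L[ℂ] V) :=
  φ.codRestrict (unitary (V →L[ℂ] V)) fun γ => by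
    have h1 : star (φ γ) * φ γ = 1 :=
      (ContinuousLinearMap.norm_map_iff_adjoint_comp_self (φ γ)).1 (h γ)
    have h2 : φ γ * φ γ⁻¹ = 1 := by rw [← map_mul, mul_inv_cancel, map_one]
    refine Unitary.mem_iff.2 ⟨h1, ?_⟩
    rw [left_inv_eq_right_inv h1 h2, h2]

lemma norm_unitary_apply (γ : Γ) (x : V) : ‖(π γ : V →L[ℂ] V) x‖ = ‖x‖ :=
  (ContinuousLinearMap.norm_map_iff_adjoint_comp_self _).2
    (Unitary.mem_iff.1 (π γ).2).1 x

/-- The unitary representation on `V^r`. -/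
noncomputable def powUnitary (r : ℕ) :
    Γ →* unitary (PiLp 2 (fun _ : Fin r => V) →L[ℂ] PiLp 2 (fun _ : Fin r => V)) :=
  unitaryOfIsometric
    { toFun γ :=
        { toLinearMap := (WithLp.linearEquiv 2 ℂ (Fin r → V)).symm.toLinearMap ∘ₗ
            (toRep π γ).compLeft (Fin r) ∘ₗ (WithLp.linearEquiv 2 ℂ (Fin r → V)).toLinearMap
          cont := by
            have h : Continuous ((toRep π γ).compLeft (Fin r)) := continuous_pi fun j =>
              (π γ : V →L[ℂ] V).continuous.comp (continuous_apply j)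
            exact (PiLp.continuous_toLp 2 _).comp (h.comp (PiLp.continuous_ofLp 2 _)) }
      map_one' := by ext; simp
      map_mul' γ γ' := by
        ext v i
        change toRep π (γ * γ') (v i) = toRep π γ (toRep π γ' (v i))
        rw [map_mul]
        rfl }
    fun γ x => by
      rw [PiLp.norm_eq_of_L2, PiLp.norm_eq_of_L2]
      exact congrArg Real.sqrt (Finset.sum_congr rfl fun i _ =>
        congrArg (· ^ 2) (norm_unitary_apply π γ (x i)))

lemma NoInvariants.powUnitary {π : Γ →* unitary (V →L[ℂ] V)} (h : NoInvariants π) (r : ℕ) :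
    NoInvariants (powUnitary π r) := by
  intro v hv
  ext i
  exact h _ fun γ => congrArg (fun w : PiLp 2 (fun _ : Fin r => V) => w i) (hv γ)

/-- Supplies the adjoints demanded by `IsPseudoinverse.comm`. -/
lemma inner_unitary_inv (γ : Γ) (x y : V) :
    inner ℂ ((π γ⁻¹ : V →L[ℂ] V) x) y = inner ℂ x ((π γ : V →L[ℂ] V) y) := by
  have h := (ContinuousLinearMap.inner_map_map_iff_adjoint_comp_self (π γ : V →L[ℂ] V)).2
    (Unitary.mem_iff.1 (π γ).2).1 ((π γ⁻¹ : V →L[ℂ] V) x) y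
  have h2 : (π γ : V →L[ℂ] V) ((π γ⁻¹ : V →L[ℂ] V) x) = x := by
    have : π γ * π γ⁻¹ = 1 := by rw [← map_mul, mul_inv_cancel, map_one]
    exact congrArg (fun u : unitary (V →L[ℂ] V) => (u : V →L[ℂ] V) x) this
  rw [← h, h2]

end UnitaryOperators

end HigherPropertyT

/-! ### Ultrapowers of unitary representations -/

namespace HigherPropertyT

section Ultrapower

open Filter Topology

lemma exists_tendsto_hyperfilter (f : ℕ → ℂ) (hf : ∃ C, ∀ k, ‖f k‖ ≤ C) :
    ∃ z, Tendsto f (hyperfilter ℕ) (𝓝 z) := by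
  obtain ⟨C, hC⟩ := hf
  obtain ⟨z, -, hz⟩ := (isCompact_closedBall (0 : ℂ) C).ultrafilter_le_nhds
    ((hyperfilter ℕ).map f) (by
      refine le_principal_iff.2 (Filter.mem_map.2 (Filter.univ_mem' fun k => ?_))
      simpa using hC k)
  exact ⟨z, hz⟩

variable (V : Type) [NormedAddCommGroup V] [InnerProductSpace ℂ V]

/-- The submodule of bounded sequences. -/
def boundedSeq : Submodule ℂ (ℕ → V) where
  carrier := {x | ∃ C, ∀ k, ‖x k‖ ≤ C}
  zero_mem' := ⟨0, fun k => by simp⟩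
  add_mem' := by
    rintro x y ⟨C, hC⟩ ⟨C', hC'⟩
    exact ⟨C + C', fun k => (norm_add_le _ _).trans (add_le_add (hC k) (hC' k))⟩
  smul_mem' := by
    rintro c x ⟨C, hC⟩
    refine ⟨‖c‖ * C, fun k => ?_⟩
    rw [Pi.smul_apply, norm_smul]
    exact mul_le_mul_of_nonneg_left (hC k) (norm_nonneg _)

/-- Bounded sequences, with the seminorm given by the limit along a nonprincipal ultrafilter. -/
def BddSeq : Type := boundedSeq V

noncomputable instance : AddCommGroup (BddSeq V) := inferInstanceAs (AddCommGroup (boundedSeq V))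

noncomputable instance : Module ℂ (BddSeq V) := inferInstanceAs (Module ℂ (boundedSeq V))

variable {V}

/-- Evaluation of a bounded sequence at an index. -/
noncomputable def BddSeq.eval (k : ℕ) : BddSeq V →ₗ[ℂ] V :=
  LinearMap.proj k ∘ₗ (boundedSeq V).subtype

/-- A bounded sequence. -/
def BddSeq.mk (x : ℕ → V) (h : ∃ C, ∀ k, ‖x k‖ ≤ C) : BddSeq V := ⟨x, h⟩

lemma BddSeq.eval_mk (x : ℕ → V) (h : ∃ C, ∀ k, ‖x k‖ ≤ C) (k : ℕ) :
    BddSeq.eval k (BddSeq.mk x h) = x k := rfl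

lemma BddSeq.ext {x y : BddSeq V} (h : ∀ k, BddSeq.eval k x = BddSeq.eval k y) : x = y :=
  Subtype.ext (funext h)

lemma BddSeq.bounded (x : BddSeq V) : ∃ C, ∀ k, ‖BddSeq.eval k x‖ ≤ C := x.2

lemma BddSeq.exists_tendsto (x y : BddSeq V) :
    ∃ z, Tendsto (fun k => inner ℂ (eval k x) (eval k y)) (hyperfilter ℕ) (𝓝 z) := by
  obtain ⟨C, hC⟩ := x.bounded
  obtain ⟨C', hC'⟩ := y.bounded
  exact exists_tendsto_hyperfilter _ ⟨C * C', fun k => (norm_inner_le_norm _ _).trans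
    (mul_le_mul (hC k) (hC' k) (norm_nonneg _) ((norm_nonneg _).trans (hC k)))⟩

variable (V) in
/-- The limit inner product on bounded sequences. -/
@[reducible] noncomputable def BddSeq.core : PreInnerProductSpace.Core ℂ (BddSeq V) where
  inner x y := (BddSeq.exists_tendsto x y).choose
  conj_inner_symm x y := by
    refine tendsto_nhds_unique (((Complex.continuous_conj.tendsto _).comp
      (BddSeq.exists_tendsto y x).choose_spec).congr fun k => ?_)
      (BddSeq.exists_tendsto x y).choose_spec
    exact inner_conj_symm _ _
  re_inner_nonneg x := by
    refine ge_of_tendsto ((Complex.continuous_re.tendsto _).comp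
      (BddSeq.exists_tendsto x x).choose_spec) (Filter.univ_mem' fun k => ?_)
    exact inner_self_nonneg (𝕜 := ℂ)
  add_left x y z := by
    refine tendsto_nhds_unique (BddSeq.exists_tendsto (x + y) z).choose_spec
      (((BddSeq.exists_tendsto x z).choose_spec.add
        (BddSeq.exists_tendsto y z).choose_spec).congr fun k => ?_)
    rw [map_add, inner_add_left]
  smul_left x y c := by
    refine tendsto_nhds_unique (BddSeq.exists_tendsto (c • x) y).choose_spec
      (((BddSeq.exists_tendsto x y).choose_spec.const_mul _).congr fun k => ?_)
    rw [map_smul, inner_smul_left]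

noncomputable instance : SeminormedAddCommGroup (BddSeq V) :=
  @InnerProductSpace.Core.toSeminormedAddCommGroup ℂ (BddSeq V) _ _ _ (BddSeq.core V)

noncomputable instance : InnerProductSpace ℂ (BddSeq V) :=
  InnerProductSpace.ofCore (BddSeq.core V)

lemma BddSeq.tendsto_inner (x y : BddSeq V) :
    Tendsto (fun k => inner ℂ (eval k x) (eval k y)) (hyperfilter ℕ) (𝓝 (inner ℂ x y)) :=
  (BddSeq.exists_tendsto x y).choose_spec

variable (V) in
/-- The ultrapower of a Hilbert space. -/
abbrev Ultrapower : Type := UniformSpace.Completion (BddSeq V)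

variable {Γ : Type} [Group Γ] [CompleteSpace V] (π : Γ →* unitary (V →L[ℂ] V))

/-- The representation on bounded sequences. -/
noncomputable def bddRep : Representation ℂ Γ (BddSeq V) where
  toFun γ :=
    { toFun x := BddSeq.mk (fun k => (π γ : V →L[ℂ] V) (BddSeq.eval k x)) (by
        simp only [norm_unitary_apply]
        exact x.bounded)
      map_add' x y := BddSeq.ext fun k => by simp [BddSeq.eval_mk]
      map_smul' c x := BddSeq.ext fun k => by simp [BddSeq.eval_mk] }
  map_one' := by
    refine LinearMap.ext fun x => BddSeq.ext fun k => ?_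
    change ((π 1 : unitary (V →L[ℂ] V)) : V →L[ℂ] V) (BddSeq.eval k x) = _
    rw [map_one]
    rfl
  map_mul' γ γ' := by
    refine LinearMap.ext fun x => BddSeq.ext fun k => ?_
    change ((π (γ * γ') : unitary (V →L[ℂ] V)) : V →L[ℂ] V) (BddSeq.eval k x) = _
    rw [map_mul]
    rfl

lemma eval_bddRep (γ : Γ) (x : BddSeq V) (k : ℕ) :
    BddSeq.eval k (bddRep π γ x) = toRep π γ (BddSeq.eval k x) := rfl

lemma norm_bddRep (γ : Γ) (x : BddSeq V) : ‖bddRep π γ x‖ = ‖x‖ := by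
  rw [@norm_eq_sqrt_re_inner ℂ, @norm_eq_sqrt_re_inner ℂ _ _ _ _ x]
  congr 2
  refine tendsto_nhds_unique (BddSeq.tendsto_inner _ _)
    ((BddSeq.tendsto_inner x x).congr fun k => ?_)
  exact ((ContinuousLinearMap.inner_map_map_iff_adjoint_comp_self (π γ : V →L[ℂ] V)).2
    (Unitary.mem_iff.1 (π γ).2).1 _ _).symm

/-- The unitary representation on the ultrapower. -/
noncomputable def ultraUnitary : Γ →* unitary (Ultrapower V →L[ℂ] Ultrapower V) :=
  unitaryOfIsometric
    { toFun γ := (LinearMap.mkContinuous (bddRep π γ) 1 fun x => by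
        rw [norm_bddRep, one_mul]).completion
      map_one' := by
        ext x
        refine UniformSpace.Completion.induction_on x (isClosed_eq (by fun_prop) (by fun_prop))
          fun a => ?_
        rw [ContinuousLinearMap.completion_apply_coe]
        change ((bddRep π 1 a : BddSeq V) : Ultrapower V) = _
        rw [map_one]
        rfl
      map_mul' γ γ' := by
        ext x
        refine UniformSpace.Completion.induction_on x (isClosed_eq (by fun_prop) (by fun_prop))
          fun a => ?_
        rw [mul_apply_eq_comp]
        repeat rw [ContinuousLinearMap.completion_apply_coe]
        change ((bddRep π (γ * γ') a : BddSeq V) : Ultrapower V) = _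
        rw [map_mul]
        rfl }
    fun γ x => by
      refine UniformSpace.Completion.induction_on x (isClosed_eq (by fun_prop) (by fun_prop))
          fun a => ?_
      change ‖(LinearMap.mkContinuous (bddRep π γ) 1 _).completion (a : Ultrapower V)‖ = _
      rw [ContinuousLinearMap.completion_apply_coe, UniformSpace.Completion.norm_coe,
        UniformSpace.Completion.norm_coe]
      exact norm_bddRep π γ a

lemma ultraUnitary_coe (γ : Γ) (x : BddSeq V) :
    toRep (ultraUnitary π) γ (x : Ultrapower V) = (bddRep π γ x : BddSeq V) :=
  ContinuousLinearMap.completion_apply_coe _ x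

variable {r s : ℕ}

/-- The vector in the power of the ultrapower given by a tuple of bounded sequences. -/
noncomputable def ultraVec (x : Fin r → BddSeq V) : PiLp 2 (fun _ : Fin r => Ultrapower V) :=
  WithLp.toLp 2 fun i => (x i : Ultrapower V)

/-- The value of a tuple of bounded sequences at an index. -/
noncomputable def vecAt (k : ℕ) (x : Fin r → BddSeq V) : PiLp 2 (fun _ : Fin r => V) :=
  WithLp.toLp 2 fun i => BddSeq.eval k (x i)

omit [CompleteSpace V] in
lemma denseRange_ultraVec : DenseRange (ultraVec : (Fin r → BddSeq V) → _) := by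
  have h1 : DenseRange fun (x : Fin r → BddSeq V) (i : Fin r) => (x i : Ultrapower V) :=
    DenseRange.piMap fun _ => UniformSpace.Completion.denseRange_coe
  exact ((WithLp.toLp_surjective 2).denseRange).comp h1 (PiLp.continuous_toLp 2 _)

omit [CompleteSpace V] in
lemma tendsto_inner_vecAt (x y : Fin r → BddSeq V) :
    Tendsto (fun k => inner ℂ (vecAt k x) (vecAt k y)) (hyperfilter ℕ)
      (𝓝 (inner ℂ (ultraVec x) (ultraVec y))) := by
  simp only [PiLp.inner_apply]
  refine tendsto_finsetSum _ fun i _ => ?_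
  change Tendsto _ _ (𝓝 (inner ℂ (x i : Ultrapower V) (y i : Ultrapower V)))
  rw [UniformSpace.Completion.inner_coe]
  exact BddSeq.tendsto_inner _ _

omit [CompleteSpace V] in
-- With `vecAt_ratMat`, this transfers norm estimates holding at every index to the ultrapower.
lemma tendsto_norm_vecAt (x : Fin r → BddSeq V) :
    Tendsto (fun k => ‖vecAt k x‖) (hyperfilter ℕ) (𝓝 ‖ultraVec x‖) := by
  simp only [@norm_eq_sqrt_re_inner ℂ]
  exact (Real.continuous_sqrt.tendsto _).comp ((Complex.continuous_re.tendsto _).comp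
    (tendsto_inner_vecAt x x))

omit [CompleteSpace V] in
lemma exists_vecAt_eq (x : ℕ → PiLp 2 (fun _ : Fin r => V)) (hx : ∃ C, ∀ k, ‖x k‖ ≤ C) :
    ∃ y : Fin r → BddSeq V, ∀ k, vecAt k y = x k := by
  obtain ⟨C, hC⟩ := hx
  exact ⟨fun i => BddSeq.mk (fun k => x k i) ⟨C, fun k => (PiLp.norm_apply_le _ _).trans (hC k)⟩,
    fun k => rfl⟩

variable (D : (Fin s → MonoidAlgebra ℚ Γ) →ₗ[MonoidAlgebra ℚ Γ] (Fin r → MonoidAlgebra ℚ Γ))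

lemma ratOp_ultraVec (x : Fin r → BddSeq V) :
    ratOp (ultraUnitary π) D (ultraVec x) = ultraVec (ratMat (bddRep π) D x) := by
  ext j
  exact (map_ratMat (UniformSpace.Completion.toComplL (𝕜 := ℂ) (E := BddSeq V)).toLinearMap
    (fun γ x => (ultraUnitary_coe π γ x).symm) D x j).symm

lemma vecAt_ratMat (x : Fin r → BddSeq V) (k : ℕ) :
    vecAt k (ratMat (bddRep π) D x) = ratOp π D (vecAt k x) := by
  ext j
  exact map_ratMat (BddSeq.eval k) (fun γ x => eval_bddRep π γ x k) D x j

end Ultrapower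

end HigherPropertyT

/-! ### Closed range of the differentials -/

namespace HigherPropertyT

section ClosedRange

open Filter Topology

variable {Γ V : Type} [Group Γ] [NormedAddCommGroup V] [InnerProductSpace ℂ V] [CompleteSpace V]
  {r : ℕ → ℕ}
  (D : ∀ q, (Fin (r (q + 1)) → MonoidAlgebra ℚ Γ) →ₗ[MonoidAlgebra ℚ Γ]
    (Fin (r q) → MonoidAlgebra ℚ Γ))

/-- The cochain complex `V^{r 0} → V^{r 1} → ⋯` attached to `D` is exact in degrees `≤ n` for every
unitary representation on a Hilbert space `V` without invariant vectors. -/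
def UnitaryExact (n : ℕ) : Prop :=
  ∀ (W : Type) [NormedAddCommGroup W] [InnerProductSpace ℂ W] [CompleteSpace W]
    (π : Γ →* unitary (W →L[ℂ] W)), NoInvariants π →
      (∀ x, ratOp π (D 0) x = 0 → x = 0) ∧
        ∀ q, q + 1 ≤ n → ∀ x, ratOp π (D (q + 1)) x = 0 → ∃ y, ratOp π (D q) y = x

variable {D} {n : ℕ}

lemma ratOp_ratOp (π : Γ →* unitary (V →L[ℂ] V)) {a b c : ℕ}
    {D : (Fin b → MonoidAlgebra ℚ Γ) →ₗ[MonoidAlgebra ℚ Γ] (Fin a → MonoidAlgebra ℚ Γ)}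
    {D' : (Fin c → MonoidAlgebra ℚ Γ) →ₗ[MonoidAlgebra ℚ Γ] (Fin b → MonoidAlgebra ℚ Γ)}
    (h : ∀ x, D (D' x) = 0) (v : PiLp 2 (fun _ : Fin a => V)) :
    ratOp π D' (ratOp π D v) = 0 := by
  rw [ratOp_apply, ratOp_apply]
  exact congrArg (WithLp.toLp 2) (ratMat_ratMat (toRep π) h _)

lemma UnitaryExact.range_eq (h : UnitaryExact D n) {π : Γ →* unitary (V →L[ℂ] V)}
    (hπ : NoInvariants π) {q : ℕ} (hD : ∀ x, D q (D (q + 1) x) = 0) (hq : q + 1 ≤ n)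
    (x : PiLp 2 (fun _ : Fin (r (q + 1)) => V)) :
    ratOp π (D (q + 1)) x = 0 ↔ ∃ y, ratOp π (D q) y = x := by
  refine ⟨(h V π hπ).2 q hq x, ?_⟩
  rintro ⟨y, rfl⟩
  exact ratOp_ratOp π hD y

lemma UnitaryExact.isClosed_range_of_lt (h : UnitaryExact D n) {π : Γ →* unitary (V →L[ℂ] V)}
    (hπ : NoInvariants π) {q : ℕ} (hD : ∀ x, D q (D (q + 1) x) = 0) (hq : q + 1 ≤ n) :
    IsClosed (Set.range (ratOp π (D q))) := by
  have : Set.range (ratOp π (D q)) = {x | ratOp π (D (q + 1)) x = 0} := by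
    ext x
    exact (h.range_eq hπ hD hq x).symm
  rw [this]
  exact isClosed_eq (ratOp π (D (q + 1))).continuous continuous_const

/-- Injectivity with closed range amounts to a lower bound `‖y‖ ≤ C * ‖ratOp π D y‖`, which survives
ultralimits and passes from a dense subset to the whole ultrapower. -/
lemma injective_ultra {π : Γ →* unitary (V →L[ℂ] V)} {a b : ℕ}
    {D : (Fin b → MonoidAlgebra ℚ Γ) →ₗ[MonoidAlgebra ℚ Γ] (Fin a → MonoidAlgebra ℚ Γ)}
    (hinj : ∀ x, ratOp π D x = 0 → x = 0) (hcl : IsClosed (Set.range (ratOp π D)))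
    (x : PiLp 2 (fun _ : Fin a => Ultrapower V)) (hx : ratOp (ultraUnitary π) D x = 0) : x = 0 := by
  obtain ⟨C, hC⟩ := (ratOp π D).antilipschitz_of_injective_of_isClosed_range
    ((injective_iff_map_eq_zero _).2 hinj) hcl
  have h1 : ∀ y, ‖y‖ ≤ C * ‖ratOp π D y‖ := fun y => by
    simpa using hC.le_mul_dist y 0
  have h2 : ∀ y, ‖y‖ ≤ C * ‖ratOp (ultraUnitary π) D y‖ := by
    intro y
    refine isClosed_property denseRange_ultraVec
      (p := fun y => ‖y‖ ≤ C * ‖ratOp (ultraUnitary π) D y‖)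
      (isClosed_le continuous_norm
        ((ratOp (ultraUnitary π) D).continuous.norm.const_mul (C : ℝ))) (fun z => ?_) y
    rw [ratOp_ultraVec]
    refine le_of_tendsto_of_tendsto' (tendsto_norm_vecAt z)
      ((tendsto_norm_vecAt _).const_mul _) fun k => ?_
    rw [vecAt_ratMat]
    exact h1 _
  have h3 := h2 x
  rw [hx, norm_zero, mul_zero] at h3
  exact norm_le_zero_iff.1 h3

/-- On an invariant vector ℚ[Γ] acts through the augmentation, with respect to which `f` is
semilinear. -/
lemma ratEval_invariant {π : Γ →* unitary (V →L[ℂ] V)} {w : V}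
    (hw : ∀ γ, (π γ : V →L[ℂ] V) w = w) {a : ℕ} (f : (Fin a → MonoidAlgebra ℚ Γ) →+ ℚ)
    (hf : ∀ γ c x, f ((MonoidAlgebra.single γ c : MonoidAlgebra ℚ Γ) • x) = c * f x)
    (x : Fin a → MonoidAlgebra ℚ Γ) :
    ratEval (toRep π) x (fun i => (f (Pi.single i 1) : ℂ) • w) = (f x : ℂ) • w := by
  have h1 : ∀ (b : MonoidAlgebra ℚ Γ) y,
      (f y : ℂ) • ratAct (toRep π) b w = (f (b • y) : ℂ) • w := by
    intro b y
    induction b using MonoidAlgebra.induction_linear with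
    | zero => simp
    | add b b' hb hb' => simp [add_smul, hb, hb']
    | single γ c =>
      have : toRep π γ w = w := hw γ
      rw [ratAct_single, hf, LinearMap.smul_apply, this, smul_smul, mul_comm]
      push_cast
      rfl
  have h2 : ∑ i, x i • (Pi.single i 1 : Fin a → MonoidAlgebra ℚ Γ) = x := by
    ext i
    simp [Finset.sum_apply, Pi.single_apply]
  rw [ratEval_apply]
  simp only [map_smul, h1]
  rw [← Finset.sum_smul, ← Rat.cast_sum, ← map_sum, h2]

/-- An invariant `w` gives the 0-cochain with entries `f (Pi.single i 1) • w`. It is a cocycle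
because `f ∘ D = 0`, hence zero, and `f ≠ 0` forces `w = 0`. -/
lemma noInvariants_of_injective {a b : ℕ} (f : (Fin a → MonoidAlgebra ℚ Γ) →+ ℚ)
    (hf : ∀ γ c x, f ((MonoidAlgebra.single γ c : MonoidAlgebra ℚ Γ) • x) = c * f x)
    (hf0 : ∃ x, f x ≠ 0)
    {D : (Fin b → MonoidAlgebra ℚ Γ) →ₗ[MonoidAlgebra ℚ Γ] (Fin a → MonoidAlgebra ℚ Γ)}
    (hD : ∀ x, f (D x) = 0) {π : Γ →* unitary (V →L[ℂ] V)}
    (hinj : ∀ x, ratOp π D x = 0 → x = 0) : NoInvariants π := by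
  intro w hw
  obtain ⟨x, hx⟩ := hf0
  have h1 : (fun i => (f (Pi.single i 1) : ℂ) • w) = 0 := by
    refine (WithLp.toLp_injective 2) (hinj (WithLp.toLp 2 fun i => (f (Pi.single i 1) : ℂ) • w) ?_)
    ext j
    refine (ratEval_invariant hw f hf _).trans ?_
    rw [hD]
    simp
  have h2 := ratEval_invariant hw f hf x
  rw [h1, map_zero] at h2
  exact (smul_eq_zero.1 h2.symm).resolve_left (by exact_mod_cast hx)

/-- Exactness for the ultrapower in degree `q` implies closed range in degree `q`. -/
lemma isClosed_range_of_ultra {π : Γ →* unitary (V →L[ℂ] V)} {a b c : ℕ}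
    {D : (Fin b → MonoidAlgebra ℚ Γ) →ₗ[MonoidAlgebra ℚ Γ] (Fin a → MonoidAlgebra ℚ Γ)}
    {D' : (Fin c → MonoidAlgebra ℚ Γ) →ₗ[MonoidAlgebra ℚ Γ] (Fin b → MonoidAlgebra ℚ Γ)}
    (hDD : ∀ x, D (D' x) = 0)
    (hex : ∀ x, ratOp (ultraUnitary π) D' x = 0 → ∃ y, ratOp (ultraUnitary π) D y = x) :
    IsClosed (Set.range (ratOp π D')) := by
  by_contra hcl
  obtain ⟨x, hx, hx1, hx0⟩ := exists_seq_of_not_isClosed_range _ hcl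
  obtain ⟨X, hX⟩ := exists_vecAt_eq x ⟨1, fun k => (hx1 k).le⟩
  have hω : (hyperfilter ℕ : Filter ℕ) ≤ atTop := Nat.hyperfilter_le_atTop
  have h1 : ‖ultraVec X‖ = 1 := by
    refine tendsto_nhds_unique (tendsto_norm_vecAt X) ?_
    simp only [hX, hx1]
    exact tendsto_const_nhds
  have h2 : ratOp (ultraUnitary π) D' (ultraVec X) = 0 := by
    rw [ratOp_ultraVec, ← norm_eq_zero]
    refine tendsto_nhds_unique (tendsto_norm_vecAt _) ?_
    simp only [vecAt_ratMat, hX]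
    exact hx0.mono_left hω
  obtain ⟨Y, hY⟩ := hex _ h2
  -- Each `x k` is orthogonal to `ker D'`, which contains `range D`; the relation passes to the
  -- ultralimit, making the cocycle orthogonal to its own primitive's image.
  have h3 : ∀ y, inner ℂ (ratOp (ultraUnitary π) D y) (ultraVec X) = 0 := by
    intro y
    refine isClosed_property denseRange_ultraVec
      (p := fun y => inner ℂ (ratOp (ultraUnitary π) D y) (ultraVec X) = 0)
      (isClosed_eq ((ratOp (ultraUnitary π) D).continuous.inner continuous_const)
        continuous_const) (fun z => ?_) y
    rw [ratOp_ultraVec]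
    refine tendsto_nhds_unique (tendsto_inner_vecAt _ _) ?_
    simp only [vecAt_ratMat, hX]
    have : ∀ k, inner ℂ (ratOp π D (vecAt k z)) (x k) = 0 := fun k =>
      hx k _ (ratOp_ratOp π hDD _)
    simp only [this]
    exact tendsto_const_nhds
  have h4 := h3 Y
  rw [hY, inner_self_eq_zero] at h4
  rw [h4, norm_zero] at h1
  exact zero_ne_one h1

theorem UnitaryExact.isClosed_range (h : UnitaryExact D n) (hn : 1 ≤ n)
    (f : (Fin (r 0) → MonoidAlgebra ℚ Γ) →+ ℚ)
    (hf : ∀ γ c x, f ((MonoidAlgebra.single γ c : MonoidAlgebra ℚ Γ) • x) = c * f x)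
    (hf0 : ∃ x, f x ≠ 0) (hfD : ∀ x, f (D 0 x) = 0)
    (hD : ∀ q, q + 1 ≤ n → ∀ x, D q (D (q + 1) x) = 0)
    {π : Γ →* unitary (V →L[ℂ] V)} (hπ : NoInvariants π) {q : ℕ} (hq : q ≤ n) :
    IsClosed (Set.range (ratOp π (D q))) := by
  obtain hq | rfl := hq.lt_or_eq
  · exact h.isClosed_range_of_lt hπ (hD q hq) hq
  obtain ⟨q, rfl⟩ : ∃ q', q = q' + 1 := ⟨q - 1, by omega⟩
  -- The first differential has closed range because its degree 0 lies strictly below `n`.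
  have hu : NoInvariants (ultraUnitary π) := noInvariants_of_injective f hf hf0 hfD
    (injective_ultra (h V π hπ).1 (h.isClosed_range_of_lt hπ (hD 0 hn) hn))
  exact isClosed_range_of_ultra (hD q le_rfl) ((h _ (ultraUnitary π) hu).2 q le_rfl)

end ClosedRange

end HigherPropertyT

/-! ### Trivial coefficients and invariance of Ext under isomorphism -/

namespace HigherPropertyT

open TensorProduct

section TrivialCoefficients

variable {Γ Λ G : Type} [Group Γ] [Group Λ] [Group G] (e : G ≃* Γ × Λ)

/-- The tensor product of trivial representations is trivial. -/
noncomputable def outerTrivialIso :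
    (outer e (Representation.trivial ℚ Γ ℚ).asModule).obj (Rep.trivial ℚ Λ ℚ) ≅
      Rep.trivial ℚ G ℚ where
  hom := Rep.ofHom (ρ := ((outer e (Representation.trivial ℚ Γ ℚ).asModule).obj
      (Rep.trivial ℚ Λ ℚ)).ρ) (σ := (Rep.trivial ℚ G ℚ).ρ)
    ⟨TensorProduct.lift ((LinearMap.mul ℚ ℚ).compl₂
      (Representation.trivial ℚ Γ ℚ).asModuleEquiv.toLinearMap), fun g => by
      apply TensorProduct.ext'
      intro y x
      have h : (Representation.trivial ℚ Γ ℚ).asModuleEquiv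
          ((MonoidAlgebra.single (e g).1 1 : MonoidAlgebra ℚ Γ) • x) =
          (Representation.trivial ℚ Γ ℚ).asModuleEquiv x := by
        rw [Representation.asModuleEquiv_map_smul]
        simp
      exact congrArg (fun z => (y : ℚ) * z) h⟩
  inv := Rep.ofHom (ρ := (Rep.trivial ℚ G ℚ).ρ) (σ := ((outer e
      (Representation.trivial ℚ Γ ℚ).asModule).obj (Rep.trivial ℚ Λ ℚ)).ρ)
    ⟨LinearMap.toSpanSingleton ℚ _
      ((1 : ℚ) ⊗ₜ[ℚ] (Representation.trivial ℚ Γ ℚ).asModuleEquiv.symm 1), fun g => by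
      refine LinearMap.ext_ring ?_
      have h : (MonoidAlgebra.single (e g).1 1 : MonoidAlgebra ℚ Γ) •
          (Representation.trivial ℚ Γ ℚ).asModuleEquiv.symm 1 =
          (Representation.trivial ℚ Γ ℚ).asModuleEquiv.symm 1 := by
        apply (Representation.trivial ℚ Γ ℚ).asModuleEquiv.injective
        rw [Representation.asModuleEquiv_map_smul]
        simp
      change (1 : ℚ) • ((1 : ℚ) ⊗ₜ[ℚ] (Representation.trivial ℚ Γ ℚ).asModuleEquiv.symm 1) =
        ((outer e (Representation.trivial ℚ Γ ℚ).asModule).obj (Rep.trivial ℚ Λ ℚ)).ρ g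
          ((1 : ℚ) • ((1 : ℚ) ⊗ₜ[ℚ] (Representation.trivial ℚ Γ ℚ).asModuleEquiv.symm 1))
      rw [one_smul]
      exact (congrArg (fun z => (1 : ℚ) ⊗ₜ[ℚ] z) h).symm⟩
  hom_inv_id := by
    apply outer_hom_ext
    intro y x
    obtain ⟨x, rfl⟩ := (Representation.trivial ℚ Γ ℚ).asModuleEquiv.symm.surjective x
    change ((y : ℚ) * (Representation.trivial ℚ Γ ℚ).asModuleEquiv
      ((Representation.trivial ℚ Γ ℚ).asModuleEquiv.symm x)) •
        ((1 : ℚ) ⊗ₜ[ℚ] (Representation.trivial ℚ Γ ℚ).asModuleEquiv.symm 1) =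
      (y : ℚ) ⊗ₜ[ℚ] (Representation.trivial ℚ Γ ℚ).asModuleEquiv.symm x
    rw [LinearEquiv.apply_symm_apply, mul_smul, ← TensorProduct.tmul_smul, ← map_smul,
      TensorProduct.smul_tmul', smul_eq_mul, smul_eq_mul, mul_one, mul_one]
  inv_hom_id := by
    apply Rep.hom_ext
    apply Representation.IntertwiningMap.ext
    refine LinearMap.ext_ring ?_
    change TensorProduct.lift ((LinearMap.mul ℚ ℚ).compl₂
      (Representation.trivial ℚ Γ ℚ).asModuleEquiv.toLinearMap)
        ((1 : ℚ) • ((1 : ℚ) ⊗ₜ[ℚ] (Representation.trivial ℚ Γ ℚ).asModuleEquiv.symm 1)) = 1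
    rw [one_smul]
    simp

variable {A : Rep.{0} ℚ Λ}

/-- The map from the trivial representation given by an invariant vector. -/
noncomputable def ofInvariant (v : A) (hv : ∀ l, A.ρ l v = v) : Rep.trivial ℚ Λ ℚ ⟶ A :=
  Rep.ofHom (ρ := (Rep.trivial ℚ Λ ℚ).ρ) (σ := A.ρ)
    ⟨LinearMap.toSpanSingleton ℚ A v, fun l => by
      refine LinearMap.ext_ring ?_
      change (1 : ℚ) • v = A.ρ l ((1 : ℚ) • v)
      rw [one_smul, hv]⟩

lemma ofInvariant_one (v : A) (hv : ∀ l, A.ρ l v = v) : (ofInvariant v hv).hom (1 : ℚ) = v :=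
  one_smul ℚ v

lemma trivial_hom_ext {f f' : Rep.trivial ℚ Λ ℚ ⟶ A} (h : f.hom (1 : ℚ) = f'.hom (1 : ℚ)) :
    f = f' := by
  apply Rep.hom_ext
  apply Representation.IntertwiningMap.ext
  exact LinearMap.ext_ring h

lemma ext_eq_zero_of_iso_left {C : Type*} [Category C] [Abelian C] [HasExt.{0} C] {X X' Y : C}
    (i : X ≅ X') {j : ℕ} (h : ∀ x : Abelian.Ext X' Y j, x = 0) (x : Abelian.Ext X Y j) : x = 0 := by
  have h1 : (Abelian.Ext.mk₀ i.hom).comp ((Abelian.Ext.mk₀ i.inv).comp x (zero_add j))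
      (zero_add j) = x := by
    rw [Abelian.Ext.mk₀_comp_mk₀_assoc, i.hom_inv_id, Abelian.Ext.mk₀_id_comp]
  rw [← h1, h ((Abelian.Ext.mk₀ i.inv).comp x (zero_add j)), Abelian.Ext.comp_zero]

lemma ext_eq_zero_of_iso_right {C : Type*} [Category C] [Abelian C] [HasExt.{0} C] {X Y Y' : C}
    (i : Y ≅ Y') {j : ℕ} (h : ∀ x : Abelian.Ext X Y' j, x = 0) (x : Abelian.Ext X Y j) : x = 0 := by
  have h1 : (x.comp (Abelian.Ext.mk₀ i.hom) (add_zero j)).comp (Abelian.Ext.mk₀ i.inv)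
      (add_zero j) = x := by
    rw [Abelian.Ext.comp_assoc_of_second_deg_zero, Abelian.Ext.mk₀_comp_mk₀, i.hom_inv_id,
      Abelian.Ext.comp_mk₀_id]
  rw [← h1, h (x.comp (Abelian.Ext.mk₀ i.hom) (add_zero j)), Abelian.Ext.zero_comp]

end TrivialCoefficients

/-! ### Unitary representations as rational ones -/

section UnitaryExt

variable {Γ Λ G : Type} [Group Γ] [Group Λ] [Group G] (e : G ≃* Γ × Λ)
  {V : Type} [NormedAddCommGroup V] [InnerProductSpace ℂ V] [CompleteSpace V]

/-- The rational representation underlying a unitary representation. -/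
noncomputable abbrev unitaryRat (π : G →* unitary (V →L[ℂ] V)) : Rep.{0} ℚ G :=
  ratRep (Rep.of (toRep π))

lemma ext_unitaryRat_eq_zero {n : ℕ} (hG : PropertyT n G) {π : G →* unitary (V →L[ℂ] V)}
    (hπ : NoInvariants π) :
    ∀ {j : ℕ}, j ≤ n → ∀ x : Abelian.Ext (Rep.trivial ℚ G ℚ) (unitaryRat π) j, x = 0
  | 0, _ => ext_zero_trivial_eq_zero hπ
  | j + 1, hj => ext_ratRep_eq_zero (hG V π hπ (j + 1) (by omega) hj)

variable (π : G →* unitary (V →L[ℂ] V))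

/-- The restriction to `Γ` of a unitary representation of `G ≃ Γ × Λ`. -/
noncomputable def leftUnitary : Γ →* unitary (V →L[ℂ] V) :=
  π.comp (e.symm.toMonoidHom.comp (MonoidHom.inl Γ Λ))

/-- The restriction to `Λ` of a unitary representation of `G ≃ Γ × Λ`. -/
noncomputable def rightUnitary : Λ →* unitary (V →L[ℂ] V) :=
  π.comp (e.symm.toMonoidHom.comp (MonoidHom.inr Γ Λ))

lemma leftRep_asAlgebraHom (b : MonoidAlgebra ℚ Γ) (v : V) :
    ((leftRep e (unitaryRat π)).asAlgebraHom b (show unitaryRat π from v) : unitaryRat π) =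
      ratAct (toRep (leftUnitary e π)) b v := by
  induction b using MonoidAlgebra.induction_linear with
  | zero =>
    rw [map_zero, map_zero]
    rfl
  | add f g hf hg =>
    rw [map_add, map_add]
    exact congrArg₂ (fun x y : V => x + y) hf hg
  | single γ c =>
    rw [ratAct_single, Representation.asAlgebraHom_single]
    rfl

variable {r s : ℕ}

/-- The bridge between algebra and analysis: the coefficient map of the adjunction is the bounded
operator. -/
lemma powMap_unitaryRat
    (D : (Fin s → MonoidAlgebra ℚ Γ) →ₗ[MonoidAlgebra ℚ Γ] (Fin r → MonoidAlgebra ℚ Γ))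
    (v : Fin r → V) :
    ((powMap e (unitaryRat π) D).hom v : Fin s → V) =
      WithLp.ofLp (ratOp (leftUnitary e π) D (WithLp.toLp 2 v)) := by
  funext j
  refine Eq.trans ?_ (ratMat_apply (V := V) (toRep (leftUnitary e π)) D v j).symm
  refine (evalPow_apply e (unitaryRat π) r v (D (Pi.single j 1))).trans ?_
  exact Finset.sum_congr (M := V) rfl fun i _ =>
    leftRep_asAlgebraHom e π (D (Pi.single j 1) i) (v i)

/-- The rational representation underlying the unitary representation on `V^r`. -/
noncomputable def powUnitaryIso (r : ℕ) :
    powRep e (unitaryRat π) r ≅ unitaryRat (powUnitary (rightUnitary e π) r) where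
  hom := Rep.ofHom (ρ := (powRep e (unitaryRat π) r).ρ)
    (σ := (unitaryRat (powUnitary (rightUnitary e π) r)).ρ)
    ⟨{ toFun := fun v => WithLp.toLp 2 (show Fin r → V from v)
       map_add' _ _ := rfl
       map_smul' _ _ := rfl }, fun _ => rfl⟩
  inv := Rep.ofHom (σ := (powRep e (unitaryRat π) r).ρ)
    (ρ := (unitaryRat (powUnitary (rightUnitary e π) r)).ρ)
    ⟨{ toFun := fun v => WithLp.ofLp (show PiLp 2 (fun _ : Fin r => V) from v)
       map_add' _ _ := rfl
       map_smul' _ _ := rfl }, fun _ => rfl⟩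
  hom_inv_id := rfl
  inv_hom_id := rfl

end UnitaryExt

/-! ### Exactness of the Hilbert space complex from property (T_n) -/

section ExactOfPropertyT

variable {Γ : Type} [Group Γ] {r : ℕ → ℕ}
    {D : ∀ q, (Fin (r (q + 1)) → MonoidAlgebra ℚ Γ) →ₗ[MonoidAlgebra ℚ Γ]
      (Fin (r q) → MonoidAlgebra ℚ Γ)}
    {ε : (Fin (r 0) → MonoidAlgebra ℚ Γ) →ₗ[MonoidAlgebra ℚ Γ]
      (Representation.trivial ℚ Γ ℚ).asModule}

theorem PropertyT.unitaryExact {n N : ℕ} (hΓ : PropertyT n Γ) (hε : Function.Surjective ε)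
    (h0 : Function.Exact (D 0) ε) (hD : ∀ q, q + 1 < N → Function.Exact (D (q + 1)) (D q))
    (hN : n + 1 ≤ N) : UnitaryExact D n := by
  intro W _ _ _ π hπ
  -- Taking the second group trivial turns `hom_outer_exact` into a statement on Γ alone; maps from
  -- the trivial representation of `Unit` are just vectors.
  let e : Γ ≃* Γ × Unit := MulEquiv.prodUnique.symm
  obtain ⟨ha, hb⟩ := hom_outer_exact e (Rep.trivial ℚ Unit ℚ) hε h0 hD (V := unitaryRat π) hN
    fun j hj => ext_eq_zero_of_iso_left (outerTrivialIso e) (ext_unitaryRat_eq_zero hΓ hπ hj)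
  have hinv : ∀ {s : ℕ} (v : powRep e (unitaryRat π) s) (l : Unit),
      (powRep e (unitaryRat π) s).ρ l v = v := by
    intro s v l
    rw [Subsingleton.elim l 1, map_one]
    rfl
  have hmap : ∀ {s t : ℕ} (D : (Fin t → MonoidAlgebra ℚ Γ) →ₗ[MonoidAlgebra ℚ Γ]
      (Fin s → MonoidAlgebra ℚ Γ)) (x : PiLp 2 (fun _ : Fin s => W)), ratOp π D x = 0 →
      ofInvariant (A := powRep e (unitaryRat π) s) (WithLp.ofLp x) (hinv _) ≫
        powMap e (unitaryRat π) D = 0 := by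
    intro s t D x hx
    apply trivial_hom_ext
    change (powMap e (unitaryRat π) D).hom ((ofInvariant (A := powRep e (unitaryRat π) s)
      (WithLp.ofLp x) (hinv _)).hom (1 : ℚ)) = 0
    rw [ofInvariant_one]
    refine (powMap_unitaryRat e π D (WithLp.ofLp x)).trans ?_
    exact congrArg WithLp.ofLp hx
  constructor
  · intro x hx
    have h := congrArg (fun f => f.hom (1 : ℚ)) (ha _ (hmap (D 0) x hx))
    exact WithLp.ofLp_injective 2 ((ofInvariant_one _ _).symm.trans h)
  · intro q hq x hx
    obtain ⟨f, hf⟩ := hb q hq _ (hmap (D (q + 1)) x hx)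
    refine ⟨WithLp.toLp 2 (show Fin (r q) → W from f.hom (1 : ℚ)), ?_⟩
    have h := congrArg (fun f => f.hom (1 : ℚ)) hf
    refine WithLp.ofLp_injective 2 ?_
    refine (powMap_unitaryRat e π (D q) (f.hom (1 : ℚ))).symm.trans ?_
    exact h.trans (ofInvariant_one _ _)

end ExactOfPropertyT

end HigherPropertyT

/-! ### The equivariant contraction and the theorem -/

namespace HigherPropertyT

section Main

variable {Γ Λ G : Type} [Group Γ] [Group Λ] [Group G] (e : G ≃* Γ × Λ)
  {V : Type} [NormedAddCommGroup V] [InnerProductSpace ℂ V] [CompleteSpace V]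
  (π : G →* unitary (V →L[ℂ] V)) {a b : ℕ}

lemma leftUnitary_rightUnitary_comm (γ : Γ) (l : Λ) (v : V) :
    toRep (leftUnitary e π) γ (toRep (rightUnitary e π) l v) =
      toRep (rightUnitary e π) l (toRep (leftUnitary e π) γ v) := by
  have h : leftUnitary e π γ * rightUnitary e π l = rightUnitary e π l * leftUnitary e π γ := by
    simp only [leftUnitary, rightUnitary, MonoidHom.comp_apply, ← map_mul]
    simp
  exact congrArg (fun u : unitary (V →L[ℂ] V) => (u : V →L[ℂ] V) v) h

lemma ratOp_powUnitary
    (D : (Fin b → MonoidAlgebra ℚ Γ) →ₗ[MonoidAlgebra ℚ Γ] (Fin a → MonoidAlgebra ℚ Γ)) (l : Λ)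
    (x : PiLp 2 (fun _ : Fin a => V)) :
    ratOp (leftUnitary e π) D ((powUnitary (rightUnitary e π) a l).1 x) =
      (powUnitary (rightUnitary e π) b l).1 (ratOp (leftUnitary e π) D x) := by
  ext j
  exact (map_ratMat (toRep (rightUnitary e π) l)
    (fun γ x => (leftUnitary_rightUnitary_comm e π γ l x).symm) D (WithLp.ofLp x) j).symm

/-- The differential commutes with Λ because Γ and Λ commute; the adjoint condition is the same fact
for `l⁻¹`. -/
lemma IsPseudoinverse.powUnitary_comm
    {D : (Fin b → MonoidAlgebra ℚ Γ) →ₗ[MonoidAlgebra ℚ Γ] (Fin a → MonoidAlgebra ℚ Γ)}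
    {S : PiLp 2 (fun _ : Fin b => V) →ₗ[ℂ] PiLp 2 (fun _ : Fin a => V)}
    (hS : IsPseudoinverse (ratOp (leftUnitary e π) D) S) (l : Λ)
    (y : PiLp 2 (fun _ : Fin b => V)) :
    S ((powUnitary (rightUnitary e π) b l).1 y) = (powUnitary (rightUnitary e π) a l).1 (S y) :=
  hS.comm (inner_unitary_inv (powUnitary (rightUnitary e π) a) l)
    (inner_unitary_inv (powUnitary (rightUnitary e π) b) l)
    (ratOp_powUnitary e π D l) (ratOp_powUnitary e π D l⁻¹) y

/-- An equivariant operator `V^b → V^a` as a map of rational representations. -/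
noncomputable def powRepOfOperator
    (S : PiLp 2 (fun _ : Fin b => V) →ₗ[ℂ] PiLp 2 (fun _ : Fin a => V))
    (hS : ∀ l y, S ((powUnitary (rightUnitary e π) b l).1 y) =
      (powUnitary (rightUnitary e π) a l).1 (S y)) :
    powRep e (unitaryRat π) b ⟶ powRep e (unitaryRat π) a :=
  Rep.ofHom (ρ := (powRep e (unitaryRat π) b).ρ) (σ := (powRep e (unitaryRat π) a).ρ)
    ⟨{ toFun := fun v => WithLp.ofLp (S (WithLp.toLp 2 (show Fin b → V from v)))
       map_add' _ _ := congrArg WithLp.ofLp (map_add S _ _)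
       map_smul' q _ := congrArg WithLp.ofLp (map_smul S (q : ℂ) _) },
      fun l => LinearMap.ext fun y =>
        congrArg WithLp.ofLp (hS l (WithLp.toLp 2 (show Fin b → V from y)))⟩

lemma exists_contraction
    (D : (Fin b → MonoidAlgebra ℚ Γ) →ₗ[MonoidAlgebra ℚ Γ] (Fin a → MonoidAlgebra ℚ Γ))
    (h : IsClosed (Set.range (ratOp (leftUnitary e π) D))) :
    ∃ (S : PiLp 2 (fun _ : Fin b => V) →ₗ[ℂ] PiLp 2 (fun _ : Fin a => V))
      (f : powRep e (unitaryRat π) b ⟶ powRep e (unitaryRat π) a),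
      IsPseudoinverse (ratOp (leftUnitary e π) D) S ∧
      ∀ v, (f.hom v : Fin a → V) = WithLp.ofLp (S (WithLp.toLp 2 (show Fin b → V from v))) := by
  obtain ⟨S, hS⟩ := exists_isPseudoinverse _ h
  exact ⟨S, powRepOfOperator e π S (hS.powUnitary_comm e π), hS, fun _ => rfl⟩

variable {π} {n m : ℕ}

theorem ext_trivial_unitaryRat_eq_zero (hn : 1 ≤ n) (hfin : FPInfty Γ) (hΓ : PropertyT n Γ)
    (hΛ : PropertyT m Λ) (hl : NoInvariants (leftUnitary e π))
    (hr : NoInvariants (rightUnitary e π)) (k : ℕ) (hk : k ≤ n + m + 1)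
    (x : Abelian.Ext (Rep.trivial ℚ G ℚ) (unitaryRat π) k) : x = 0 := by
  -- `ext_outer_vanish` needs exactness over a range of length at least `n + m + 1`.
  obtain ⟨P, hP⟩ := hfin (n + m + 2)
  obtain ⟨r, D, ε, hε, h0, hD⟩ := (finiteFreeUpTo_of_projectiveResolution P hP).exists_complex
  replace h0 := h0 (by omega)
  have hex : UnitaryExact D n := hΓ.unitaryExact hε h0 hD (by omega)
  have hDD : ∀ q, q + 1 ≤ n → ∀ x, D q (D (q + 1) x) = 0 := fun q hq x =>
    (hD q (by omega)).apply_apply_eq_zero x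
  -- The augmentation `ε` with values read in ℚ.
  let f : (Fin (r 0) → MonoidAlgebra ℚ Γ) →+ ℚ :=
    (Representation.trivial ℚ Γ ℚ).asModuleEquiv.toLinearMap.toAddMonoidHom.comp ε.toAddMonoidHom
  have hcl : ∀ q, q ≤ n → IsClosed (Set.range (ratOp (leftUnitary e π) (D q))) := fun q hq => by
    refine hex.isClosed_range hn f ?_ ?_ ?_ hDD hl hq
    · intro γ c x
      change (Representation.trivial ℚ Γ ℚ).asModuleEquiv (ε _) = _
      rw [map_smul, Representation.asModuleEquiv_map_smul, Representation.asAlgebraHom_single]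
      rfl
    · obtain ⟨x, hx⟩ := hε ((Representation.trivial ℚ Γ ℚ).asModuleEquiv.symm 1)
      refine ⟨x, ?_⟩
      change (Representation.trivial ℚ Γ ℚ).asModuleEquiv (ε x) ≠ 0
      rw [hx, LinearEquiv.apply_symm_apply]
      exact one_ne_zero
    · intro x
      change (Representation.trivial ℚ Γ ℚ).asModuleEquiv (ε (D 0 x)) = 0
      rw [h0.apply_apply_eq_zero, map_zero]
  have hS : ∀ q, ∃ (S : PiLp 2 (fun _ : Fin (r (q + 1)) => V) →ₗ[ℂ]
        PiLp 2 (fun _ : Fin (r q) => V))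
      (f : powRep e (unitaryRat π) (r (q + 1)) ⟶ powRep e (unitaryRat π) (r q)), q ≤ n →
      IsPseudoinverse (ratOp (leftUnitary e π) (D q)) S ∧
      ∀ v, (f.hom v : Fin (r q) → V) =
        WithLp.ofLp (S (WithLp.toLp 2 (show Fin (r (q + 1)) → V from v))) := by
    intro q
    by_cases hq : q ≤ n
    · obtain ⟨S, f, h⟩ := exists_contraction e π (D q) (hcl q hq)
      exact ⟨S, f, fun _ => h⟩
    -- Beyond degree `n` no contraction is needed, so zero is a harmless default.
    · exact ⟨0, 0, fun h => absurd h hq⟩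
  choose S h hS using hS
  refine ext_eq_zero_of_iso_left (outerTrivialIso e).symm (fun x => ?_) x
  refine ext_outer_vanish e (Rep.trivial ℚ Λ ℚ) hε h0 hD (by omega) ?_ h ?_ ?_ k hk x
  · intro q j hj
    exact ext_eq_zero_of_iso_right (powUnitaryIso e π (r q))
      (ext_unitaryRat_eq_zero hΛ (hr.powUnitary (r q)) hj)
  · apply Rep.hom_ext
    apply Representation.IntertwiningMap.ext
    refine LinearMap.ext fun v => ?_
    change (h 0).hom ((powMap e (unitaryRat π) (D 0)).hom v) = v
    refine ((hS 0 (by omega)).2 _).trans ?_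
    rw [powMap_unitaryRat e π (D 0) v]
    -- The pseudoinverse of an injective operator is a left inverse.
    have h1 := (hS 0 (by omega)).1.apply_apply (WithLp.toLp 2 (show Fin (r 0) → V from v))
    rw [← sub_eq_zero, ← map_sub] at h1
    exact congrArg WithLp.ofLp (sub_eq_zero.1 ((hex V _ hl).1 _ h1))
  · intro q hq
    apply Rep.hom_ext
    apply Representation.IntertwiningMap.ext
    refine LinearMap.ext fun v => ?_
    have h1 : (h (q + 1)).hom ((powMap e (unitaryRat π) (D (q + 1))).hom v) =
        WithLp.ofLp (S (q + 1) (ratOp (leftUnitary e π) (D (q + 1))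
          (WithLp.toLp 2 (show Fin (r (q + 1)) → V from v)))) := by
      refine ((hS (q + 1) hq).2 _).trans ?_
      rw [powMap_unitaryRat e π (D (q + 1)) v]
    have h2 : (powMap e (unitaryRat π) (D q)).hom ((h q).hom v) =
        WithLp.ofLp (ratOp (leftUnitary e π) (D q) (S q
          (WithLp.toLp 2 (show Fin (r (q + 1)) → V from v)))) := by
      refine (powMap_unitaryRat e π (D q) _).trans ?_
      rw [(hS q (by omega)).2]
    refine (congrArg₂ (fun x y : Fin (r (q + 1)) → V => x + y) h1 h2).trans ?_
    exact congrArg WithLp.ofLp ((hS q (by omega)).1.add_eq (hS (q + 1) hq).1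
      (hex.range_eq hl (hDD q hq) hq) (WithLp.toLp 2 (show Fin (r (q + 1)) → V from v)))

end Main

end HigherPropertyT

theorem lemma2 (n m : ℕ) (hn : 1 ≤ n) (hm : 1 ≤ m)
    (Γ Λ : Type) [Group Γ] [Group Λ]
    (hΓfin : HigherPropertyT.FPInfty Γ)
    (hΓ : HigherPropertyT.PropertyT n Γ) (hΛ : HigherPropertyT.PropertyT m Λ)
    (V : Type) [NormedAddCommGroup V] [InnerProductSpace ℂ V] [CompleteSpace V]
    (π : Γ × Λ →* unitary (V →L[ℂ] V))
    (hVΓ : HigherPropertyT.NoInvariants (π.comp (MonoidHom.inl Γ Λ)))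
    (hVΛ : HigherPropertyT.NoInvariants (π.comp (MonoidHom.inr Γ Λ)))
    (k : ℕ) (hk : k ≤ n + m + 1) :
    Subsingleton (HigherPropertyT.cohomology π k) := by
  rcases k with _ | k
  -- Degree 0 is the space of invariants; the comparison with `Ext` over ℚ is made in positive
  -- degrees.
  · exact HigherPropertyT.subsingleton_groupCohomology_zero fun v hv =>
      hVΓ v fun γ => hv (γ, 1)
  · exact HigherPropertyT.subsingleton_groupCohomology_of_ratRep
      (HigherPropertyT.ext_trivial_unitaryRat_eq_zero (MulEquiv.refl (Γ × Λ)) hn hΓfin hΓ hΛ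
        hVΓ hVΛ (k + 1) hk)
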